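/- **Conventions.** A domain $\Phi$ is a finite set of proposition symbols, a $\Phi$-assignment is a map $s:\Phi\to\{0,1\}$, and a $\Phi$-team is a (possibly empty) set of $\Phi$-assignments. For a set $\Sigma\subseteq\{\sim,\land,\lor,\mathbin{\dot\lor}\}$ of connectives, the $\mathrm{PL}(\Sigma)$-formulas are built by the connectives in $\Sigma$ from the literals $\top,\bot,p,\neg p$ and $\sim\!\top,\sim\!\bot,\sim\!p,\sim\!\neg p$. For a team $T$: $T\vDash\top$ always; $T\vDash\bot$ iff $T=\emptyset$; $T\vDash p$ (resp. $\neg p$) iff $s(p)=1$ (resp. $0$) for all $s\in T$; $T\vDash{\sim}\psi$ iff $T\nvDash\psi$; $\land$ is conjunction; $T\vDash\psi\lor\theta$ iff $T=S\cup U$ for some $S\vDash\psi$, $U\vDash\theta$; and $\mathbin{\dot\lor}$ is the same with $S\cap U=\emptyset$. The length $|\varphi|$ of a formula is its length as a string, each proposition symbol counting as one symbol. A formula is purely propositional if it is a $\mathrm{PL}(\{\land,\lor\})$-formula without $\sim$; then $s(\alpha)=1$ iff $\{s\}\vDash\alpha$, and $s(\vec\alpha)=(s(\alpha_1),\dots,s(\alpha_n))$.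 For tuples, $|\vec\alpha|=\sum_i|\alpha_i|$, and $\vec\alpha\vec\beta$ is the concatenation. The atoms of dependency are: - dependence: $T\vDash{=}(\vec\alpha;\vec\beta)$ iff for all $s,s'\in T$, $s(\vec\alpha)=s'(\vec\alpha)$ implies $s(\vec\beta)=s'(\vec\beta)$; - exclusion: $T\vDash\vec\alpha\mid\vec\beta$ iff $s(\vec\alpha)\ne s'(\vec\beta)$ for all $s,s'\in T$; - inclusion: $T\vDash\vec\alpha\subseteq\vec\beta$ iff for every $s\in T$ there is $s'\in T$ with $s(\vec\alpha)=s'(\vec\beta)$; - conditional independence: $T\vDash\vec\alpha\perp_{\vec\gamma}\vec\beta$ iff for all $s,s'\in T$ with $s(\vec\gamma)=s'(\vec\gamma)$ there is $s''\in T$ with $s(\vec\alpha\vec\gamma)=s''(\vec\alpha\vec\gamma)$ and $s'(\vec\beta)=s''(\vec\beta)$; - anonymity: $T\vDash\vec\alpha\,\Upsilon\,\vec\beta$ iff for every $s\in T$ there is $s'\in T$ with $s(\vec\alpha)=s'(\vec\alpha)$ and $s(\vec\beta)\ne s'(\vec\beta)$. An atom is equivalent to a formula if both are satisfied by the same $\Phi$-teams,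 for every domain $\Phi$ that contains the propositions of both. **Theorem.** Let $\Sigma=\{\sim,\land,\lor\}$ or $\Sigma=\{\sim,\land,\mathbin{\dot\lor}\}$. Let $\vec\alpha=(\alpha_1,\dots,\alpha_n)$, $\vec\beta=(\beta_1,\dots,\beta_m)$, $\vec\gamma=(\gamma_1,\dots,\gamma_k)$ be tuples of purely propositional formulas, $n,m,k\ge 0$, with $n=m$ in the cases of exclusion and inclusion. There is a constant $C$ that does not depend on the tuples such that each of the following atoms is equivalent to a $\mathrm{PL}(\Sigma)$-formula $\varphi$, containing only propositions of the atom, of the stated length: - dependence ${=}(\vec\alpha;\vec\beta)$, with $|\varphi|\le C\,(|\vec\alpha\vec\beta|+1)$; - exclusion $\vec\alpha\mid\vec\beta$, with $|\varphi|\le C\,(n|\vec\alpha\vec\beta|+1)$; - inclusion $\vec\alpha\subseteq\vec\beta$, with $|\varphi|\le C\,(n|\vec\alpha\vec\beta|+1)$; - conditional independence $\vec\alpha\perp_{\vec\gamma}\vec\beta$, with $|\varphi|\le C\,(n(n+m+k)|\vec\alpha\vec\beta\vec\gamma|+1)$; - anonymity $\vec\alpha\,\Upsilon\,\vec\beta$,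 with $|\varphi|\le C\,(\max(n,1)|\vec\beta|+m|\vec\alpha|+1)$. (Thus, for non-empty tuples, the bounds are $\mathcal O(|\vec\alpha\vec\beta|)$, $\mathcal O(n|\vec\alpha\vec\beta|)$, $\mathcal O(n|\vec\alpha\vec\beta|)$, $\mathcal O(n(n+m+k)|\vec\alpha\vec\beta\vec\gamma|)$ and $\mathcal O(n|\vec\beta|+m|\vec\alpha|)$.) Furthermore, for each of the five kinds of atoms, these formulas can be computed from the tuples in logarithmic space, i.e. by one deterministic Turing machine with a read-only input tape, a write-only output tape, and $\mathcal O(\log N)$ cells on its work tapes for inputs of length $N$ over a finite alphabet (propositions being written with binary indices). -/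

import Mathlib

/-! ### Formulas of propositional team logic

Proposition symbols are natural numbers. -/

/-- The connectives `∼` (Boolean negation), `∧`, `∨` (lax splitting disjunction) and
`∨̇` (strict splitting disjunction). -/
inductive Connective
  | tilde
  | conj
  | lax
  | strict

/-- All formulas that can be built from `⊤`, `⊥`, `p`, `¬p` with these connectives. -/
inductive Formula
  | top
  | bot
  | pos (p : ℕ)
  | neg (p : ℕ)
  | tilde (φ : Formula)
  | conj (φ ψ : Formula)
  | lax (φ ψ : Formula)
  | strict (φ ψ : Formula)

/-- The symbols occurring in formulas written as strings.  The proposition `p` is one symbol. -/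
inductive Token
  | top
  | bot
  | prop (p : ℕ)
  | neg
  | tilde
  | conj
  | lax
  | strict
  | lpar
  | rpar

namespace Formula

/-- `⊤`, `⊥`, `p` and `¬p`. -/
inductive IsBasic : Formula → Prop
  | top : IsBasic top
  | bot : IsBasic bot
  | pos (p : ℕ) : IsBasic (pos p)
  | neg (p : ℕ) : IsBasic (neg p)

/-- `PL Sg φ` : `φ` is a `PL(Σ)`-formula.  The literals are the basic formulas and their Boolean
negations; they are available whatever `Σ` is. -/
inductive PL (Sg : Set Connective) : Formula → Prop
  | basic {φ : Formula} : IsBasic φ → PL Sg φ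
  | tildeBasic {φ : Formula} : IsBasic φ → PL Sg (tilde φ)
  | tilde {φ : Formula} : Connective.tilde ∈ Sg → PL Sg φ → PL Sg (tilde φ)
  | conj {φ ψ : Formula} : Connective.conj ∈ Sg → PL Sg φ → PL Sg ψ → PL Sg (conj φ ψ)
  | lax {φ ψ : Formula} : Connective.lax ∈ Sg → PL Sg φ → PL Sg ψ → PL Sg (lax φ ψ)
  | strict {φ ψ : Formula} : Connective.strict ∈ Sg → PL Sg φ → PL Sg ψ → PL Sg (strict φ ψ)

/-- No occurrence of `∼`. -/
def TildeFree : Formula → Prop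
  | top => True
  | bot => True
  | pos _ => True
  | neg _ => True
  | tilde _ => False
  | conj φ ψ => TildeFree φ ∧ TildeFree ψ
  | lax φ ψ => TildeFree φ ∧ TildeFree ψ
  | strict φ ψ => TildeFree φ ∧ TildeFree ψ

/-- The set `Prop(φ)` of proposition symbols occurring in `φ`. -/
def props : Formula → Finset ℕ
  | top => ∅
  | bot => ∅
  | pos p => {p}
  | neg p => {p}
  | tilde φ => props φ
  | conj φ ψ => props φ ∪ props ψ
  | lax φ ψ => props φ ∪ props ψ
  | strict φ ψ => props φ ∪ props ψ

/-- The formula as a string; binary connectives are written infix, in parentheses. -/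
def tokens : Formula → List Token
  | top => [.top]
  | bot => [.bot]
  | pos p => [.prop p]
  | neg p => [.neg, .prop p]
  | tilde φ => .tilde :: tokens φ
  | conj φ ψ => .lpar :: (tokens φ ++ .conj :: (tokens ψ ++ [.rpar]))
  | lax φ ψ => .lpar :: (tokens φ ++ .lax :: (tokens ψ ++ [.rpar]))
  | strict φ ψ => .lpar :: (tokens φ ++ .strict :: (tokens ψ ++ [.rpar]))

/-- The length of the string, every proposition counting as one symbol. -/
def length (φ : Formula) : ℕ := φ.tokens.length

end Formula

/-! ### Team semantics -/

/-- Assignments on the domain `D`. -/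
abbrev Assignment (D : Finset ℕ) := {p : ℕ // p ∈ D} → Bool

/-- Teams with domain `D`. -/
abbrev Team (D : Finset ℕ) := Set (Assignment D)

/-- `T.Sat φ`, meant for domains that contain all propositions of `φ`. -/
def Team.Sat {D : Finset ℕ} : Team D → Formula → Prop
  | _, .top => True
  | T, .bot => T = ∅
  | T, .pos p => ∀ s ∈ T, ∃ h : p ∈ D, s ⟨p, h⟩ = true
  | T, .neg p => ∀ s ∈ T, ∃ h : p ∈ D, s ⟨p, h⟩ = false
  | T, .tilde φ => ¬ Team.Sat T φ
  | T, .conj φ ψ => Team.Sat T φ ∧ Team.Sat T ψ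
  | T, .lax φ ψ => ∃ S U : Team D, S ∪ U = T ∧ Team.Sat S φ ∧ Team.Sat U ψ
  | T, .strict φ ψ =>
      ∃ S U : Team D, S ∪ U = T ∧ S ∩ U = ∅ ∧ Team.Sat S φ ∧ Team.Sat U ψ

/-- Purely propositional formulas: `∼`-free formulas over `∧` and (lax) `∨`. -/
def PureFormula : Type :=
  {α : Formula // α.PL {Connective.conj, Connective.lax} ∧ α.TildeFree}

/-- Tuples of purely propositional formulas, possibly empty; `a ++ b` is the concatenation. -/
abbrev Tuple := List PureFormula

namespace Tuple

/-- The length `|a|` of a tuple: the sum of the lengths of its entries.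
The number of entries is `List.length a`. -/
def size (a : Tuple) : ℕ := (a.map fun α => α.1.length).sum

/-- The propositions occurring in a tuple. -/
def props (a : Tuple) : Finset ℕ := a.foldr (fun α D => α.1.props ∪ D) ∅

open Classical in
/-- The vector `s(a)` of truth values, where `s(α) = 1` iff `{s} ⊨ α`. -/
noncomputable def value {D : Finset ℕ} (s : Assignment D) (a : Tuple) : List Bool :=
  a.map fun α => decide (Team.Sat {s} α.1)

end Tuple

/-! ### Atoms of dependency -/

/-- The atoms: dependence `dep(a; b)`, exclusion `a | b`, inclusion `a ⊆ b`,
conditional independence `a ⊥_c b` (arguments in the order `a`, `b`, `c`) and anonymity `a Υ b`.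
Exclusion and inclusion are used only for tuples `a`, `b` with equally many entries. -/
inductive DependencyAtom
  | dep (a b : Tuple)
  | excl (a b : Tuple)
  | incl (a b : Tuple)
  | condIndep (a b c : Tuple)
  | anon (a b : Tuple)

namespace DependencyAtom

open Tuple

/-- The propositions occurring in an atom. -/
def props : DependencyAtom → Finset ℕ
  | dep a b => a.props ∪ b.props
  | excl a b => a.props ∪ b.props
  | incl a b => a.props ∪ b.props
  | condIndep a b c => a.props ∪ b.props ∪ c.props
  | anon a b => a.props ∪ b.props

/-- The team `T` satisfies the atom. -/
def SatBy {D : Finset ℕ} (T : Team D) : DependencyAtom → Prop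
  | dep a b => ∀ s ∈ T, ∀ s' ∈ T, value s a = value s' a → value s b = value s' b
  | excl a b => ∀ s ∈ T, ∀ s' ∈ T, value s a ≠ value s' b
  | incl a b => ∀ s ∈ T, ∃ s' ∈ T, value s a = value s' b
  | condIndep a b c => ∀ s ∈ T, ∀ s' ∈ T, value s c = value s' c →
      ∃ s'' ∈ T, value s (a ++ c) = value s'' (a ++ c) ∧ value s' b = value s'' b
  | anon a b => ∀ s ∈ T, ∃ s' ∈ T, value s a = value s' a ∧ value s b ≠ value s' b

/-- The atom is equivalent to the formula `φ`: every team whose domain contains the propositions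
of both satisfies the one iff it satisfies the other. -/
def Equivalent (A : DependencyAtom) (φ : Formula) : Prop :=
  ∀ D : Finset ℕ, A.props ∪ φ.props ⊆ D → ∀ T : Team D, A.SatBy T ↔ T.Sat φ

/-- `φ` is a `PL(Σ)`-formula in the propositions of the atom `A`, and equivalent to `A`. -/
def DefinedBy (Sg : Set Connective) (A : DependencyAtom) (φ : Formula) : Prop :=
  φ.PL Sg ∧ φ.props ⊆ A.props ∧ A.Equivalent φ

end DependencyAtom

/-! ### Logarithmic space

Deterministic Turing machines with a two-way read-only input tape between end markers, finitely
many one-way infinite work tapes, and a write-only output tape.  Only work tapes count as space. -/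

/-- Head movements. -/
inductive Movement
  | left
  | stay
  | right

/-- What the input head may see. -/
inductive InputCell (A : Type)
  | leftEnd
  | symbol (a : A)
  | rightEnd

/-- One action: new state, movement of the input head, symbols written on the work tapes,
movements of the work heads, and a finite word appended to the output. -/
structure Instruction (Q K Γ B : Type) where
  next : Q
  inMove : Movement
  write : K → Γ
  move : K → Movement
  emit : List B

/-- A machine with input alphabet `A`, output alphabet `B`, states `Q`, work tapes indexed by `K`,
and work alphabet `Γ`.  It halts where `step` is `none`. -/
structure Transducer (A B : Type) where
  Q : Type
  K : Type
  Γ : Type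
  finite_Q : Finite Q
  finite_K : Finite K
  finite_Γ : Finite Γ
  start : Q
  blank : Γ
  step : Q → InputCell A → (K → Γ) → Option (Instruction Q K Γ B)

namespace Transducer

variable {A B : Type} (M : Transducer A B)

/-- Configurations.  The input head is at position `0` on the left end marker, at position `i + 1`
on the `i`-th input symbol (counting from `0`), and at position `n + 1` on the right end marker,
where `n` is the length of the input. -/
structure Config where
  state : M.Q
  inPos : ℕ
  head : M.K → ℕ
  tape : M.K → ℕ → M.Γ
  out : List B

/-- The initial configuration: all work tapes are blank, nothing has been written. -/
def init : M.Config where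
  state := M.start
  inPos := 0
  head := fun _ => 0
  tape := fun _ _ => M.blank
  out := []

/-- The cell of the input tape at a position. -/
def readInput (w : List A) : ℕ → InputCell A
  | 0 => .leftEnd
  | i + 1 => match w[i]? with
    | some a => .symbol a
    | none => .rightEnd

/-- Moving a head on a tape with a leftmost cell `0`. -/
def moveHead : Movement → ℕ → ℕ
  | .left, i => i - 1
  | .stay, i => i
  | .right, i => i + 1

/-- One step on the input `w`.  The input head never leaves the cells `0, …, |w| + 1`. -/
def stepOn (w : List A) (c : M.Config) : Option M.Config :=
  (M.step c.state (readInput w c.inPos) (fun k => c.tape k (c.head k))).map fun x =>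
    { state := x.next
      inPos := min (moveHead x.inMove c.inPos) (w.length + 1)
      head := fun k => moveHead (x.move k) (c.head k)
      tape := fun k => Function.update (c.tape k) (c.head k) (x.write k)
      out := c.out ++ x.emit }

/-- `M.Reaches w c d`: on the input `w`, finitely many steps lead from `c` to `d`. -/
def Reaches (w : List A) : M.Config → M.Config → Prop :=
  Relation.ReflTransGen fun c d => M.stepOn w c = some d

/-- On the input `w` the machine halts with the output `v`, and its work heads never visit
more than the first `space` cells of each work tape. -/
def ComputesIn (space : ℕ) (w : List A) (v : List B) : Prop :=
  (∃ c, M.Reaches w M.init c ∧ M.stepOn w c = none ∧ c.out = v) ∧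
    ∀ c, M.Reaches w M.init c → ∀ k, c.head k < space

end Transducer

/-- A function `f` on a set of objects `X`, given by the strings `inp x` of its arguments and
`out x` of its values, is computable in logarithmic space: some machine turns `inp x` into `out x`
for all `x`, within `O(log n)` cells of its work tapes, where `n` is the length of `inp x`. -/
def LogspaceComputable {X A B : Type} (inp : X → List A) (out : X → List B) : Prop :=
  ∃ (M : Transducer A B) (c : ℕ), ∀ x,
    M.ComputesIn (c * (Nat.log 2 (inp x).length + 1)) (inp x) (out x)

/-! ### Formulas and tuples as strings over a finite alphabet -/

/-- A finite alphabet.  A proposition is written as the symbol `prop` followed by its binary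
index; `comma` ends an entry of a tuple, and `semicolon` ends a tuple. -/
inductive Letter
  | top
  | bot
  | prop
  | digit (b : Bool)
  | neg
  | tilde
  | conj
  | lax
  | strict
  | lpar
  | rpar
  | comma
  | semicolon

/-- A symbol as a word over the finite alphabet. -/
def Token.encode : Token → List Letter
  | top => [.top]
  | bot => [.bot]
  | prop p => .prop :: (Nat.bits p).map .digit
  | neg => [.neg]
  | tilde => [.tilde]
  | conj => [.conj]
  | lax => [.lax]
  | strict => [.strict]
  | lpar => [.lpar]
  | rpar => [.rpar]

/-- A formula as a word over the finite alphabet. -/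
def Formula.encode (φ : Formula) : List Letter := φ.tokens.flatMap Token.encode

/-- A tuple as a word over the finite alphabet. -/
def Tuple.encode (a : Tuple) : List Letter :=
  (a.flatMap fun α => α.1.encode ++ [.comma]) ++ [.semicolon]

/-!
Throughout, `σ : Bool` selects the disjunction `∨` or `∨̇`, written `dis σ`.

**The formulas.**  `sub σ φ` (that is, `φ ∨ ⊤`) says that some subteam satisfies `φ`, and
`lit σ x α` says that `α` has the truth value `x` throughout the team; for `x = 0` it forbids
non-empty subteams satisfying `α`, so that no dual of `α` is needed.  A disjunction with a condition
`ψ` on single assignments means the same in its lax and its strict reading: some subteam satisfies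
the first part and contains all assignments violating `ψ` (`sat_dis_of_flat`).  Hence
`∼(φ ∨ ψ)` quantifies over all subteams that retain the assignments violating `ψ`.

Dependence says that every subteam on which `a` is constant is one on which `b` is.  For the other
atoms the assignments `s`, `s'`, `s''` of the definition have to be told apart inside one subteam,
which is done by the value of an entry on which they must differ:

* exclusion fails if some `s` has `s(a) = s(b)`, or if `s(a) = s'(b)` for some `s`, `s'` that
  differ on an entry of `a` (otherwise `s'(a) = s(a) = s'(b)`);
* in inclusion, `s` is a witness for itself unless `a` and `b` disagree on it at some index `j`, say
  `s(aⱼ) = x ≠ s(bⱼ)`.  All possible witnesses `s'` have `s'(bⱼ) = x`; retaining these and an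
  arbitrary selection of the others isolates `s`;
* anonymity for `b` is a disjunction of anonymity for the single entries of `b`: each class of
  assignments with equal values of `a` goes to an entry of `b` that is not constant on it.  For a
  single entry `β`, all assignments with one value of `β` are retained, and a selection of those
  with the other;
* in conditional independence, `s` or `s'` is a witness unless they differ on an entry `aⱼ` and on
  an entry `bₗ`.  Then `s`, `s'`, `s''` have three different pairs of values of `(aⱼ, bₗ)`, and all
  possible `s''` are retained together with a selection of the others (`sat_indepCorner`).

**Logarithmic space.**  `Realizes P` says that some finite control, acting on binary counters that
are stored on the work tapes, leads from `s` to `t` whenever `P w s t`.  Such relations are closed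
under composition and loops, and contain the increments and decrements of counters; an increasing
or decreasing run through the bits is verified once (`tapePath_carry`, `tapePath_borrow`).  On top
of this, `Writes` says that a word depending on the input tuples and on at most three loop indices
can be appended to the output.  Constant words and entries of the tuples can be written, and
concatenations and loops over the entries of a tuple preserve the property (`Writes.loop`); the
encodings of the formulas are built in this way.
-/

section

open Relation Transducer

/-! ### Routines on binary counters -/

/-- What a machine can change besides its state, when its work alphabet is `Option Bool`. -/
structure Memory (B K : Type) where
  inPos : ℕ
  head : K → ℕ
  tape : K → ℕ → Option Bool
  out : List B

/-- A machine with input alphabet `A`, output alphabet `B`, and work tapes indexed by `K` over the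
alphabet `Option Bool`, whose blank is `none`. -/
structure Routine (A B K : Type) where
  Q : Type
  finite_Q : Finite Q
  start : Q
  step : Q → InputCell A → (K → Option Bool) → Option (Instruction Q K (Option Bool) B)

/-- The values of finitely many counters, with the position of the input head and the output. -/
@[ext]
structure CounterState (B K : Type) where
  pos : ℕ
  cnt : K → ℕ
  out : List B

/-- The tape that holds a word in the cells `1, 2, …`.  Cell `0` stays blank, so that a head that
moves left over the word notices when it has arrived there. -/
def tapeOf (l : List Bool) : ℕ → Option Bool
  | 0 => none
  | i + 1 => l[i]?

section Routine

variable {A B K : Type}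

namespace Memory

/-- The effect of an instruction on the input `w`, apart from the change of state. -/
def act {Q : Type} (w : List A) (m : Memory B K) (x : Instruction Q K (Option Bool) B) :
    Memory B K where
  inPos := min (moveHead x.inMove m.inPos) (w.length + 1)
  head := fun k => moveHead (x.move k) (m.head k)
  tape := fun k => Function.update (m.tape k) (m.head k) (x.write k)
  out := m.out ++ x.emit

/-- The symbols under the work heads. -/
def scanned (m : Memory B K) (k : K) : Option Bool := m.tape k (m.head k)

end Memory

namespace Instruction

/-- The instruction that only changes the state, when `g` are the symbols under the heads. -/
def idle {Q : Type} (q : Q) (g : K → Option Bool) : Instruction Q K (Option Bool) B where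
  next := q
  inMove := .stay
  write := g
  move := fun _ => .stay
  emit := []

/-- Renaming the next state. -/
def mapState {Q Q' : Type} (f : Q → Q') (x : Instruction Q K (Option Bool) B) :
    Instruction Q' K (Option Bool) B where
  next := f x.next
  inMove := x.inMove
  write := x.write
  move := x.move
  emit := x.emit

end Instruction

theorem Memory.act_idle {Q : Type} {w : List A} {m : Memory B K} (h : m.inPos ≤ w.length + 1)
    (q : Q) : m.act w (Instruction.idle q m.scanned) = m := by
  cases m
  simp_all [Memory.act, Instruction.idle, Memory.scanned, moveHead]

namespace Routine

/-- One step on the input `w`. -/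
def next (R : Routine A B K) (w : List A) (c : R.Q × Memory B K) : Option (R.Q × Memory B K) :=
  (R.step c.1 (readInput w c.2.inPos) c.2.scanned).map fun x => (x.next, c.2.act w x)

/-- Finitely many steps, all of them from configurations whose work heads are on the first `S`
cells. -/
def Path (R : Routine A B K) (w : List A) (S : ℕ) :
    R.Q × Memory B K → R.Q × Memory B K → Prop :=
  ReflTransGen fun c d => R.next w c = some d ∧ ∀ k, c.2.head k < S

end Routine

/-- The memory that stores the counters in binary, least significant bit first, with the work heads
on cell `1`. -/
def CounterState.mem (s : CounterState B K) : Memory B K where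
  inPos := s.pos
  head := fun _ => 1
  tape := fun k => tapeOf (Nat.bits (s.cnt k))
  out := s.out

/-- The number of cells that suffice for counters with values up to the length of the input.
Besides the bits, the heads visit the blank cell `0` and the cell behind the last bit. -/
def space (w : List A) : ℕ := Nat.size w.length + 3

theorem one_lt_space (w : List A) : 1 < space w := by unfold space; omega

/-- Some routine, working on the first `space w` cells of its tapes, goes from `s` to `t` and
halts there, whenever `P w s t`. -/
def Realizes (P : List A → CounterState B K → CounterState B K → Prop) : Prop :=
  ∃ R : Routine A B K, ∀ w s t, P w s t → s.pos ≤ w.length + 1 →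
    t.pos ≤ w.length + 1 ∧
      ∃ q, R.Path w (space w) (R.start, s.mem) (q, t.mem) ∧ R.next w (q, t.mem) = none

namespace Realizes

variable {P P₁ P₂ : List A → CounterState B K → CounterState B K → Prop}

theorem mono (h : Realizes P₁) (h' : ∀ w s t, P₂ w s t → P₁ w s t) : Realizes P₂ := by
  obtain ⟨R, hR⟩ := h
  exact ⟨R, fun w s t hst => hR w s t (h' w s t hst)⟩

theorem seq (h₁ : Realizes P₁) (h₂ : Realizes P₂) :
    Realizes fun w s t => ∃ u, P₁ w s u ∧ P₂ w u t := by
  obtain ⟨R₁, h₁⟩ := h₁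
  obtain ⟨R₂, h₂⟩ := h₂
  have := R₁.finite_Q
  have := R₂.finite_Q
  let R : Routine A B K :=
    { Q := R₁.Q ⊕ R₂.Q
      finite_Q := inferInstance
      start := .inl R₁.start
      step := fun q a g => match q with
        | .inl q => match R₁.step q a g with
          | some x => some (x.mapState .inl)
          | none => some (.idle (.inr R₂.start) g)
        | .inr q => (R₂.step q a g).map (·.mapState .inr) }
  have next_inr : ∀ w c, R.next w (.inr c.1, c.2) =
      (R₂.next w c).map fun d => (.inr d.1, d.2) := by
    intro w c
    simp only [Routine.next, R, Option.map_map]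
    rfl
  refine ⟨R, fun w s t ⟨u, hu, ht⟩ hs => ?_⟩
  obtain ⟨hup, q₁, p₁, n₁⟩ := h₁ w s u hu hs
  obtain ⟨htp, q₂, p₂, n₂⟩ := h₂ w u t ht hup
  refine ⟨htp, .inr q₂, ?_, ?_⟩
  · refine ReflTransGen.trans (b := (.inl q₁, u.mem)) ?_
      (ReflTransGen.head (b := (.inr R₂.start, u.mem)) ⟨?_, fun k => one_lt_space w⟩ ?_)
    · refine ReflTransGen.lift (fun c : R₁.Q × Memory B K => ((.inl c.1, c.2) : R.Q × Memory B K))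
        (fun c d ⟨hcd, hb⟩ => ⟨?_, hb⟩) _ _ p₁
      simp only [Routine.next, Option.map_eq_some_iff] at hcd ⊢
      obtain ⟨x, hx, rfl⟩ := hcd
      exact ⟨x.mapState .inl, by simp only [R, hx], rfl⟩
    · simp only [Routine.next, Option.map_eq_none_iff] at n₁
      simp only [Routine.next, R, n₁, Option.map_some]
      rw [Memory.act_idle hup]
      rfl
    · refine ReflTransGen.lift (fun c : R₂.Q × Memory B K => ((.inr c.1, c.2) : R.Q × Memory B K))
        (fun c d ⟨hcd, hb⟩ => ⟨?_, hb⟩) _ _ p₂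
      rw [next_inr, hcd]
      rfl
  · rw [next_inr w (q₂, t.mem), n₂]
    rfl

end Realizes

/-- The run of a loop with body `P` from `s` to `t` on the input `w`.  The test sees the letter
under the input head, and which of the counters are zero. -/
inductive WhileRel (test : InputCell A → (K → Bool) → Bool)
    (P : List A → CounterState B K → CounterState B K → Prop) (w : List A) :
    CounterState B K → CounterState B K → Prop
  | done {s} : test (readInput w s.pos) (fun k => s.cnt k == 0) = false → WhileRel test P w s s
  | step {s u t} : test (readInput w s.pos) (fun k => s.cnt k == 0) = true → P w s u →
      WhileRel test P w u t → WhileRel test P w s t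

theorem CounterState.isNone_scanned (s : CounterState B K) (k : K) :
    (s.mem.scanned k).isNone = (s.cnt k == 0) := by
  simp only [Memory.scanned, CounterState.mem, tapeOf]
  rcases Nat.eq_zero_or_pos (s.cnt k) with h | h
  · simp [h]
  · have : (Nat.bits (s.cnt k)).length ≠ 0 := by
      rw [Nat.size_eq_bits_len, Nat.size_eq_zero.ne]; omega
    rw [List.getElem?_eq_getElem (by omega)]
    simp; omega

namespace Realizes

variable {P : List A → CounterState B K → CounterState B K → Prop}

theorem whileLoop (test : InputCell A → (K → Bool) → Bool) (h : Realizes P) :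
    Realizes (WhileRel test P) := by
  obtain ⟨R₁, h₁⟩ := h
  have := R₁.finite_Q
  let R : Routine A B K :=
    { Q := Option R₁.Q
      finite_Q := inferInstance
      start := none
      step := fun q a g => match q with
        | none => if test a (fun k => (g k).isNone) then some (.idle (some R₁.start) g) else none
        | some q => match R₁.step q a g with
          | some x => some (x.mapState some)
          | none => some (.idle none g) }
  refine ⟨R, fun w s t hst => ?_⟩
  induction hst with
  | @done s ht =>
    refine fun hs => ⟨hs, none, .refl, ?_⟩
    have : (fun k => (s.mem.scanned k).isNone) = fun k => s.cnt k == 0 :=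
      funext s.isNone_scanned
    have ht' : test (readInput w s.mem.inPos) (fun k => s.cnt k == 0) = false := ht
    simp only [Routine.next, R, this, ht']
    rfl
  | @step s u t ht hu _ ih =>
    intro hs
    obtain ⟨hup, q₁, p₁, n₁⟩ := h₁ w s u hu hs
    obtain ⟨htp, q, p, n⟩ := ih hup
    refine ⟨htp, q, ?_, n⟩
    refine ReflTransGen.head (b := (some R₁.start, s.mem)) ⟨?_, fun k => one_lt_space w⟩ ?_
    · have : (fun k => (s.mem.scanned k).isNone) = fun k => s.cnt k == 0 :=
        funext s.isNone_scanned
      have ht' : test (readInput w s.mem.inPos) (fun k => s.cnt k == 0) = true := ht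
      simp only [Routine.next, R, this, ht', if_true, Option.map_some]
      rw [Memory.act_idle hs]
      rfl
    refine ReflTransGen.trans (b := (some q₁, u.mem)) ?_
      (ReflTransGen.head (b := (none, u.mem)) ⟨?_, fun k => one_lt_space w⟩ p)
    · refine ReflTransGen.lift (fun c : R₁.Q × Memory B K => ((some c.1, c.2) : R.Q × Memory B K))
        (fun c d ⟨hcd, hb⟩ => ⟨?_, hb⟩) _ _ p₁
      simp only [Routine.next, Option.map_eq_some_iff] at hcd ⊢
      obtain ⟨x, hx, rfl⟩ := hcd
      exact ⟨x.mapState some, by simp only [R, hx], rfl⟩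
    · simp only [Routine.next, Option.map_eq_none_iff] at n₁
      simp only [Routine.next, R, n₁, Option.map_some]
      rw [Memory.act_idle hup]
      rfl

/-- Moving the input head once and writing a word that depends on the letter just read. -/
theorem inputStep (mv : Movement) (em : InputCell A → List B) :
    Realizes fun w (s t : CounterState B K) =>
      t = ⟨min (moveHead mv s.pos) (w.length + 1), s.cnt, s.out ++ em (readInput w s.pos)⟩ := by
  let R : Routine A B K :=
    { Q := Bool
      finite_Q := inferInstance
      start := true
      step := fun q a g => match q with
        | true => some ⟨false, mv, g, fun _ => .stay, em a⟩
        | false => none }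
  refine ⟨R, fun w s t hst hs => ⟨by rw [hst]; exact min_le_right _ _, false,
    .single ⟨?_, fun k => one_lt_space w⟩, rfl⟩⟩
  subst hst
  simp [Routine.next, R, CounterState.mem, Memory.act, Memory.scanned, moveHead]

end Realizes

end Routine

/-! ### Binary counters -/

/-- The states of the control that adds one to a binary counter or subtracts one from it. -/
inductive CounterPhase
  | carry
  | borrow
  | check
  | erase
  | back
  | done

instance : Finite CounterPhase :=
  Finite.of_surjective (fun i : Fin 6 =>
    ([.carry, .borrow, .check, .erase, .back, .done] : List CounterPhase)[i])
    fun q => by cases q <;> [use 0; use 1; use 2; use 3; use 4; use 5] <;> rfl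

/-- The control on one tape: the next state, the symbol written and the movement. -/
def counterStep : CounterPhase → Option Bool → Option (CounterPhase × Option Bool × Movement)
  | .carry, some true => some (.carry, some false, .right)
  | .carry, some false => some (.back, some true, .left)
  | .carry, none => some (.back, some true, .left)
  | .borrow, some false => some (.borrow, some true, .right)
  | .borrow, some true => some (.check, some false, .right)
  | .borrow, none => none
  -- a bit `1` just turned into `0`; a leading `0` has to be erased
  | .check, none => some (.erase, none, .left)
  | .check, some b => some (.back, some b, .left)
  | .erase, _ => some (.back, none, .left)
  | .back, some b => some (.back, some b, .left)
  | .back, none => some (.done, none, .right)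
  | .done, _ => none

/-- Finitely many steps of the control on one tape, from head positions below `S`. -/
def TapePath (S : ℕ) :
    CounterPhase × ℕ × (ℕ → Option Bool) → CounterPhase × ℕ × (ℕ → Option Bool) → Prop :=
  ReflTransGen fun c d => c.2.1 < S ∧ ∃ x, counterStep c.1 (c.2.2 c.2.1) = some x ∧
    d = (x.1, moveHead x.2.2 c.2.1, Function.update c.2.2 c.2.1 x.2.1)

theorem TapePath.head {S h : ℕ} {q q' : CounterPhase} {f f' : ℕ → Option Bool} {v : Option Bool}
    {m : Movement} {d : CounterPhase × ℕ × (ℕ → Option Bool)}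
    (hS : h < S) (hx : counterStep q (f h) = some (q', v, m)) (hf : Function.update f h v = f')
    (hd : TapePath S (q', moveHead m h, f') d) : TapePath S (q, h, f) d :=
  ReflTransGen.head ⟨hS, (q', v, m), hx, by rw [hf]⟩ hd

/-- Adding one to a binary number, least significant bit first. -/
def incBits : List Bool → List Bool
  | [] => [true]
  | false :: l => true :: l
  | true :: l => false :: incBits l

/-- Subtracting one from a positive binary number without leading zeros, least significant bit
first. -/
def decBits : List Bool → List Bool
  | [] => []
  | false :: l => true :: decBits l
  | [true] => []
  | true :: b :: l => false :: b :: l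

theorem incBits_bits (n : ℕ) : incBits n.bits = (n + 1).bits := by
  induction n using Nat.strong_induction_on with
  | _ n ih =>
    rcases Nat.even_or_odd' n with ⟨m, rfl | rfl⟩
    · rcases Nat.eq_zero_or_pos m with rfl | hm
      · simp [incBits]
      · rw [Nat.bit0_bits _ hm.ne', Nat.bit1_bits]; rfl
    · rw [Nat.bit1_bits, show 2 * m + 1 + 1 = 2 * (m + 1) by ring, Nat.bit0_bits _ (by omega),
        ← ih m (by omega)]
      rfl

theorem decBits_bits (n : ℕ) : decBits (n + 1).bits = n.bits := by
  induction n using Nat.strong_induction_on with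
  | _ n ih =>
    rcases Nat.even_or_odd' n with ⟨m, rfl | rfl⟩
    · rw [Nat.bit1_bits]
      rcases Nat.eq_zero_or_pos m with rfl | hm
      · simp [decBits]
      · rw [Nat.bit0_bits _ hm.ne']
        have : (Nat.bits m).length ≠ 0 := by
          rw [Nat.size_eq_bits_len, Nat.size_eq_zero.ne]; omega
        cases hb : Nat.bits m with
        | nil => simp [hb] at this
        | cons b l => rfl
    · rw [show 2 * m + 1 + 1 = 2 * (m + 1) by ring, Nat.bit0_bits _ (by omega), Nat.bit1_bits,
        ← ih m (by omega)]
      rfl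

theorem true_mem_bits {n : ℕ} (h : 0 < n) : true ∈ n.bits := by
  induction n using Nat.strong_induction_on with
  | _ n ih =>
    rcases Nat.even_or_odd' n with ⟨m, rfl | rfl⟩
    · rw [Nat.bit0_bits _ (by omega)]
      exact List.mem_cons_of_mem _ (ih m (by omega) (by omega))
    · rw [Nat.bit1_bits]
      exact List.mem_cons_self

theorem tapeOf_append_cons (P l : List Bool) (b : Bool) :
    tapeOf (P ++ b :: l) (P.length + 1) = some b := by
  simp [tapeOf]

theorem tapeOf_length_add_one (P : List Bool) : tapeOf P (P.length + 1) = none := by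
  simp [tapeOf]

theorem update_tapeOf (P l : List Bool) (b c : Bool) :
    Function.update (tapeOf (P ++ b :: l)) (P.length + 1) (some c) = tapeOf (P ++ c :: l) := by
  funext i
  rcases i with _ | i
  · simp [tapeOf, Function.update]
  · by_cases h : i = P.length
    · subst h; simp [tapeOf]
    · rw [Function.update_of_ne (by omega)]
      simp only [tapeOf, List.getElem?_append]
      split_ifs with h'
      · rfl
      · obtain ⟨j, hj⟩ : ∃ j, i - P.length = j + 1 := ⟨i - P.length - 1, by omega⟩
        simp [hj]

theorem update_tapeOf_append (P : List Bool) (c : Bool) :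
    Function.update (tapeOf P) (P.length + 1) (some c) = tapeOf (P ++ [c]) := by
  funext i
  rcases i with _ | i
  · simp [tapeOf, Function.update]
  · by_cases h : i = P.length
    · subst h; simp [tapeOf]
    · rw [Function.update_of_ne (by omega)]
      simp only [tapeOf, List.getElem?_append]
      split_ifs with h'
      · rfl
      · obtain ⟨j, hj⟩ : ∃ j, i - P.length = j + 1 := ⟨i - P.length - 1, by omega⟩
        simp [hj]; omega

theorem update_tapeOf_erase (P : List Bool) (c : Bool) :
    Function.update (tapeOf (P ++ [c])) (P.length + 1) none = tapeOf P := by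
  rw [← update_tapeOf_append, Function.update_idem, ← tapeOf_length_add_one P,
    Function.update_eq_self]

theorem tapePath_back {S : ℕ} (l : List Bool) (h : ℕ) (hl : h ≤ l.length) (hS : h < S) :
    TapePath S (.back, h, tapeOf l) (.done, 1, tapeOf l) := by
  induction h with
  | zero => exact TapePath.head hS (v := none) (m := .right) rfl (Function.update_eq_self 0 _) .refl
  | succ h ih =>
    have : tapeOf l (h + 1) = some l[h] := by simp [tapeOf]
    refine TapePath.head (q' := .back) (v := some l[h]) (m := .left) hS (by rw [this]; rfl) ?_
      (ih (by omega) (by omega))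
    rw [← this, Function.update_eq_self]

theorem tapePath_carry {S : ℕ} (l P : List Bool) (hS : (P ++ incBits l).length + 1 < S) :
    TapePath S (.carry, P.length + 1, tapeOf (P ++ l)) (.done, 1, tapeOf (P ++ incBits l)) := by
  induction l generalizing P with
  | nil =>
    simp only [incBits, List.length_append, List.length_cons, List.length_nil] at hS ⊢
    refine TapePath.head (q' := .back) (v := some true) (m := .left) (by omega) ?_ ?_
      (tapePath_back _ _ ?_ ?_)
    · rw [List.append_nil, tapeOf_length_add_one]; rfl
    · rw [List.append_nil, update_tapeOf_append]
    · simp [moveHead]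
    · simp only [moveHead]; omega
  | cons b l ih =>
    cases b with
    | false =>
      simp only [incBits, List.length_append, List.length_cons] at hS ⊢
      refine TapePath.head (q' := .back) (v := some true) (m := .left) (by omega) ?_
        (update_tapeOf _ _ _ _) (tapePath_back _ _ ?_ ?_)
      · rw [tapeOf_append_cons]; rfl
      · simp [moveHead]
      · simp only [moveHead]; omega
    | true =>
      have := ih (P ++ [false])
      simp only [incBits, List.length_append, List.length_cons, List.append_assoc,
        List.cons_append, List.nil_append, List.length_nil] at hS this ⊢
      refine TapePath.head (q' := .carry) (v := some false) (m := .right) (by omega) ?_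
        (update_tapeOf _ _ _ _) (this (by omega))
      rw [tapeOf_append_cons]; rfl

theorem tapePath_borrow {S : ℕ} (l P : List Bool) (hl : true ∈ l)
    (hS : (P ++ l).length + 1 < S) :
    TapePath S (.borrow, P.length + 1, tapeOf (P ++ l)) (.done, 1, tapeOf (P ++ decBits l)) := by
  induction l generalizing P with
  | nil => simp at hl
  | cons b l ih =>
    cases b with
    | false =>
      have := ih (P ++ [true]) (by simpa using hl)
      simp only [decBits, List.length_append, List.length_cons, List.append_assoc,
        List.cons_append, List.nil_append, List.length_nil] at hS this ⊢
      refine TapePath.head (q' := .borrow) (v := some true) (m := .right) (by omega) ?_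
        (update_tapeOf _ _ _ _) (this (by omega))
      rw [tapeOf_append_cons]; rfl
    | true =>
      refine TapePath.head (q' := .check) (v := some false) (m := .right) ?_ ?_
        (update_tapeOf _ _ _ _) ?_
      · simp only [List.length_append, List.length_cons] at hS; omega
      · rw [tapeOf_append_cons]; rfl
      cases l with
      | nil =>
        simp only [decBits, List.length_append, List.length_cons, List.length_nil] at hS ⊢
        refine TapePath.head (q' := .erase) (v := none) (m := .left)
          (by simp only [moveHead]; omega) ?_ (f' := tapeOf (P ++ [false])) ?_ ?_
        · simp [moveHead, tapeOf, counterStep]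
        · have : tapeOf (P ++ [false]) (P.length + 1 + 1) = none := by simp [tapeOf]
          simp only [moveHead]
          rw [← this, Function.update_eq_self]
        · simp only [moveHead, Nat.add_sub_cancel]
          refine TapePath.head (q' := .back) (v := none) (m := .left) (by omega) ?_
            (update_tapeOf_erase P false) ?_
          · rfl
          · rw [List.append_nil]
            exact tapePath_back _ _ (by simp [moveHead]) (by simp only [moveHead]; omega)
      | cons b l =>
        simp only [decBits, List.length_append, List.length_cons] at hS ⊢
        have : tapeOf (P ++ false :: b :: l) (P.length + 1 + 1) = some b := by
          simp [tapeOf]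
        refine TapePath.head (q' := .back) (v := some b) (m := .left)
          (by simp only [moveHead]; omega) (by simp only [moveHead]; rw [this]; rfl)
          (f' := tapeOf (P ++ false :: b :: l)) ?_
          (tapePath_back _ _ ?_ ?_)
        · simp only [moveHead]
          rw [← this, Function.update_eq_self]
        · simp [moveHead]
        · simp only [moveHead]; omega

section Counters

variable {A B K : Type} [DecidableEq K]

/-- The one-tape control, started in the state `q`, on the tape `k`. -/
def counterRoutine (q : CounterPhase) (k : K) : Routine A B K where
  Q := CounterPhase
  finite_Q := inferInstance
  start := q
  step := fun q _ g => (counterStep q (g k)).map fun x =>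
    ⟨x.1, .stay, Function.update g k x.2.1, Function.update (fun _ => .stay) k x.2.2, []⟩

theorem path_counterRoutine {q₀ : CounterPhase} {k : K} {w : List A} {s : CounterState B K}
    {n : ℕ} {q : CounterPhase} (hs : s.pos ≤ w.length + 1)
    (h : TapePath (space w) (q₀, 1, tapeOf (s.cnt k).bits) (q, 1, tapeOf n.bits)) :
    (counterRoutine q₀ k : Routine A B K).Path w (space w) (q₀, s.mem)
      (q, (CounterState.mem ⟨s.pos, Function.update s.cnt k n, s.out⟩)) := by
  let F : CounterPhase × ℕ × (ℕ → Option Bool) → CounterPhase × Memory B K := fun c =>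
    (c.1, ⟨s.pos, Function.update (fun _ => 1) k c.2.1,
      Function.update (fun k => tapeOf (s.cnt k).bits) k c.2.2, s.out⟩)
  have key : (counterRoutine q₀ k : Routine A B K).Path w (space w)
      (F (q₀, 1, tapeOf (s.cnt k).bits)) (F (q, 1, tapeOf n.bits)) := by
    refine ReflTransGen.lift F (fun c d ⟨hc, x, hx, hd⟩ => ⟨?_, fun j => ?_⟩) _ _ h
    · simp only [Routine.next, counterRoutine, F, Memory.scanned, Function.update_self, hx, hd,
        Option.map_some, Option.some.injEq, Prod.mk.injEq, true_and]
      simp only [Memory.act, Memory.mk.injEq, List.append_nil, and_true]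
      refine ⟨by simpa [moveHead] using hs, ?_, ?_⟩
      · funext j
        by_cases hj : j = k
        · subst hj; simp
        · simp [hj, moveHead]
      · funext j
        by_cases hj : j = k
        · subst hj; simp
        · simp [hj, Memory.scanned]
    · by_cases hj : j = k
      · subst hj; simpa [F] using hc
      · simpa [F, hj] using one_lt_space w
  have h₁ : F (q₀, 1, tapeOf (s.cnt k).bits) = (q₀, s.mem) := by
    simp [F, CounterState.mem]
  have h₂ : F (q, 1, tapeOf n.bits) =
      (q, CounterState.mem ⟨s.pos, Function.update s.cnt k n, s.out⟩) := by
    simp only [F, CounterState.mem, Prod.mk.injEq, Memory.mk.injEq, true_and, and_true]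
    refine ⟨by simp, ?_⟩
    funext j
    by_cases hj : j = k
    · subst hj; simp
    · simp [hj]
  rwa [h₁, h₂] at key

theorem length_bits_lt_space {w : List A} {n : ℕ} (h : n ≤ w.length) :
    n.bits.length + 1 < space w := by
  have := Nat.size_le_size h
  rw [Nat.size_eq_bits_len, space]
  omega

namespace Realizes

theorem inc (k : K) : Realizes fun (w : List A) (s t : CounterState B K) =>
    s.cnt k + 1 ≤ w.length ∧ t = ⟨s.pos, Function.update s.cnt k (s.cnt k + 1), s.out⟩ := by
  refine ⟨counterRoutine .carry k, fun w s t ⟨h, ht⟩ hs => ?_⟩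
  subst ht
  refine ⟨hs, .done, path_counterRoutine hs ?_, rfl⟩
  have := tapePath_carry (S := space w) (s.cnt k).bits [] (by
    rw [incBits_bits]; exact length_bits_lt_space h)
  rwa [incBits_bits] at this

theorem dec (k : K) : Realizes fun (w : List A) (s t : CounterState B K) =>
    s.cnt k ≤ w.length ∧ 0 < s.cnt k ∧
      t = ⟨s.pos, Function.update s.cnt k (s.cnt k - 1), s.out⟩ := by
  refine ⟨counterRoutine .borrow k, fun w s t ⟨h, h0, ht⟩ hs => ?_⟩
  subst ht
  refine ⟨hs, .done, path_counterRoutine hs ?_, rfl⟩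
  have := tapePath_borrow (S := space w) (s.cnt k).bits [] (true_mem_bits h0)
    (length_bits_lt_space h)
  obtain ⟨n, hn⟩ : ∃ n, s.cnt k = n + 1 := ⟨s.cnt k - 1, by omega⟩
  rw [hn] at this ⊢
  rwa [decBits_bits] at this

end Realizes

end Counters

/-! ### From routines to logarithmic space -/

section

variable {A B K : Type}

/-- A deterministic run that ends only passes through configurations with a property that holds
along one known run to the end. -/
theorem forall_reachable_of_run {C : Type} {step : C → Option C} {good : C → Prop} {c d : C}
    (h : ReflTransGen (fun c d => step c = some d ∧ good c) c d) (hd : step d = none)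
    (gd : good d) {e : C} (he : ReflTransGen (fun c d => step c = some d) c e) : good e := by
  induction h using ReflTransGen.head_induction_on with
  | refl =>
    rcases ReflTransGen.cases_head he with rfl | ⟨x, hx, _⟩
    · exact gd
    · simp [hd] at hx
  | head hcc _ ih =>
    rcases ReflTransGen.cases_head he with rfl | ⟨x, hx, hxe⟩
    · exact hcc.2
    · rw [hcc.1, Option.some_inj] at hx
      subst hx
      exact ih hxe

/-- The machine that puts its work heads on cell `1` and then follows a routine. -/
def Routine.toTransducer (R : Routine A B K) [Finite K] : Transducer A B where
  Q := Option R.Q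
  K := K
  Γ := Option Bool
  finite_Q := by have := R.finite_Q; infer_instance
  finite_K := inferInstance
  finite_Γ := inferInstance
  start := none
  blank := none
  step := fun q a g => match q with
    | none => some ⟨some R.start, .stay, fun _ => none, fun _ => .right, []⟩
    | some q => (R.step q a g).map (·.mapState some)

/-- The configuration of the machine of a routine. -/
def Routine.config (R : Routine A B K) [Finite K] (c : R.Q × Memory B K) :
    R.toTransducer.Config :=
  ⟨some c.1, c.2.inPos, c.2.head, c.2.tape, c.2.out⟩

theorem Routine.stepOn_config (R : Routine A B K) [Finite K] (w : List A)
    (c : R.Q × Memory B K) :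
    R.toTransducer.stepOn w (R.config c) = (R.next w c).map R.config := by
  change ((R.step c.1 (readInput w c.2.inPos) c.2.scanned).map _).map _ =
    ((R.step c.1 (readInput w c.2.inPos) c.2.scanned).map _).map _
  cases R.step c.1 (readInput w c.2.inPos) c.2.scanned <;> rfl

theorem space_le (w : List A) : space w ≤ 4 * (Nat.log 2 w.length + 1) := by
  have : Nat.size w.length ≤ Nat.log 2 w.length + 1 :=
    Nat.size_le.2 (Nat.lt_pow_succ_log_self (by norm_num) _)
  unfold space
  omega

theorem LogspaceComputable.of_realizes [Finite K] {X : Type} {inp : X → List A}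
    {out : X → List B} {P : List A → CounterState B K → CounterState B K → Prop}
    (h : Realizes P) (hP : ∀ x, ∃ p c, P (inp x) ⟨0, fun _ => 0, []⟩ ⟨p, c, out x⟩) :
    LogspaceComputable inp out := by
  obtain ⟨R, hR⟩ := h
  refine ⟨R.toTransducer, 4, fun x => ?_⟩
  obtain ⟨p, c, hp⟩ := hP x
  obtain ⟨-, q, path, halt⟩ := hR _ _ _ hp (Nat.zero_le _)
  set w := inp x
  set d := R.config (q, CounterState.mem ⟨p, c, out x⟩)
  have run : ReflTransGen (fun c d => R.toTransducer.stepOn w c = some d ∧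
      ∀ k, c.head k < space w) R.toTransducer.init d := by
    refine ReflTransGen.head (b := R.config (R.start, CounterState.mem ⟨0, fun _ => 0, []⟩))
      ⟨?_, fun k => ?_⟩ ?_
    · simp only [Transducer.stepOn, Routine.toTransducer, Transducer.init, Routine.config,
        CounterState.mem, Option.map_some, Option.some.injEq, moveHead]
      congr 1
      funext k i
      cases i <;> simp [tapeOf]
    · exact Nat.zero_lt_one.trans (one_lt_space w)
    · refine ReflTransGen.lift R.config (fun c d ⟨hcd, hb⟩ => ⟨?_, hb⟩) _ _ path
      rw [R.stepOn_config, hcd]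
      rfl
  have halt' : R.toTransducer.stepOn w d = none := by
    rw [R.stepOn_config, halt]; rfl
  refine ⟨⟨d, ReflTransGen.mono (fun _ _ h => h.1) _ _ run, halt', rfl⟩, fun c hc k => ?_⟩
  exact (forall_reachable_of_run run halt' (fun k => one_lt_space w) hc k).trans_le (space_le w)

/-! ### Loops over the input -/

theorem WhileRel.of_steps {test : InputCell A → (K → Bool) → Bool}
    {P : List A → CounterState B K → CounterState B K → Prop} {w : List A}
    (f : ℕ → CounterState B K) (n : ℕ)
    (hstep : ∀ i < n, test (readInput w (f i).pos) (fun k => (f i).cnt k == 0) = true ∧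
      P w (f i) (f (i + 1)))
    (hn : test (readInput w (f n).pos) (fun k => (f n).cnt k == 0) = false) :
    WhileRel test P w (f 0) (f n) := by
  induction n generalizing f with
  | zero => exact .done hn
  | succ n ih =>
    exact .step (hstep 0 (by omega)).1 (hstep 0 (by omega)).2
      (ih (fun i => f (i + 1)) (fun i hi => hstep (i + 1) (by omega)) hn)

theorem readInput_append_cons (pre post : List A) (a : A) :
    readInput (pre ++ a :: post) (pre.length + 1) = .symbol a := by
  simp [readInput]

/-- Whether a cell holds a letter for which `final` fails. -/
def InputCell.passes (final : A → Bool) : InputCell A → Bool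
  | .symbol a => !final a
  | _ => false

/-- The word that is written for a cell. -/
def InputCell.image (em : A → List B) : InputCell A → List B
  | .symbol a => em a
  | _ => []

/-- Whether a cell is the left end marker. -/
def InputCell.isLeftEnd : InputCell A → Bool
  | .leftEnd => true
  | _ => false

namespace Realizes

/-- Reading the input to the right up to the first letter with `final`, and writing the image of
what is read. -/
theorem scan (final : A → Bool) (em : A → List B) :
    Realizes fun w (s t : CounterState B K) => ∃ pre u c post, w = pre ++ (u ++ c :: post) ∧
      (∀ a ∈ u, final a = false) ∧ final c = true ∧ s.pos = pre.length + 1 ∧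
      t = ⟨pre.length + u.length + 1, s.cnt, s.out ++ u.flatMap em⟩ := by
  refine (whileLoop (fun a _ => a.passes final)
    (inputStep .right (InputCell.image em))).mono ?_
  rintro w s t ⟨pre, u, c, post, rfl, hu, hc, hs, rfl⟩
  have := WhileRel.of_steps (test := fun a _ => a.passes final)
    (P := fun w (s t : CounterState B K) => t = ⟨min (moveHead .right s.pos) (w.length + 1), s.cnt,
      s.out ++ InputCell.image em (readInput w s.pos)⟩) (w := pre ++ (u ++ c :: post))
    (fun i => ⟨pre.length + i + 1, s.cnt, s.out ++ (u.take i).flatMap em⟩) u.length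
    (fun i hi => ?_) ?_
  · convert this using 1
    · exact CounterState.ext (by simpa using hs) rfl (by simp)
    · simp
  · have hcell : readInput (pre ++ (u ++ c :: post)) (pre.length + i + 1) = .symbol u[i] := by
      simp [readInput, List.getElem?_append, hi]
    simp only [hcell, InputCell.passes, hu _ (List.getElem_mem hi), InputCell.image, moveHead]
    refine ⟨rfl, ?_⟩
    refine CounterState.ext (by simp; omega) rfl ?_
    rw [List.take_add_one, List.getElem?_eq_getElem hi, Option.toList_some, List.flatMap_append,
      List.flatMap_singleton, List.append_assoc]
  · have := readInput_append_cons (pre ++ u) post c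
    rw [List.append_assoc, List.length_append] at this
    simp only [this, InputCell.passes, hc]
    rfl

/-- Returning to the left end of the input. -/
theorem rewind : Realizes fun w (s t : CounterState B K) =>
    s.pos ≤ List.length (α := A) w + 1 ∧ t = ⟨0, s.cnt, s.out⟩ := by
  refine (whileLoop (fun a _ => !a.isLeftEnd)
    (inputStep .left fun _ => [])).mono ?_
  rintro w s t ⟨hs, rfl⟩
  have := WhileRel.of_steps (test := fun a _ => !a.isLeftEnd)
    (P := fun w (s t : CounterState B K) => t = ⟨min (moveHead .left s.pos) (w.length + 1), s.cnt,
      s.out ++ []⟩) (w := w) (fun i => ⟨s.pos - i, s.cnt, s.out⟩) s.pos (fun i hi => ?_) ?_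
  · simpa using this
  · constructor
    · obtain ⟨j, hj⟩ : ∃ j, s.pos - i = j + 1 := ⟨s.pos - i - 1, by omega⟩
      simp only [hj, readInput]
      cases w[j]? <;> rfl
    · exact CounterState.ext (by simp [moveHead]; omega) rfl (by simp)
  · simp [readInput, InputCell.isLeftEnd]

/-- Moving the contents of the counter `k` to the counter `l`, with an action `P` for each unit. -/
theorem transfer [DecidableEq K] {k l : K} (hkl : k ≠ l)
    {P : List A → CounterState B K → CounterState B K → Prop} (hP : Realizes P) :
    Realizes fun w (s t : CounterState B K) => ∃ (c : K → ℕ) (n : ℕ) (p : ℕ → ℕ) (o : List B),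
      n ≤ w.length ∧
      (∀ i < n, ∀ c, P w ⟨p i, c, o⟩ ⟨p (i + 1), c, o⟩) ∧
      s = ⟨p 0, Function.update (Function.update c k n) l 0, o⟩ ∧
      t = ⟨p n, Function.update (Function.update c k 0) l n, o⟩ := by
  refine (whileLoop (fun _ z => !z k) ((dec k).seq ((inc l).seq hP))).mono ?_
  rintro w s t ⟨c, n, p, o, hn, hp, rfl, rfl⟩
  have := WhileRel.of_steps (test := fun (_ : InputCell A) z => !z k) (w := w)
    (P := fun w (s t : CounterState B K) => ∃ u : CounterState B K,
      (s.cnt k ≤ w.length ∧ 0 < s.cnt k ∧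
        u = ⟨s.pos, Function.update s.cnt k (s.cnt k - 1), s.out⟩) ∧
      ∃ v : CounterState B K, (u.cnt l + 1 ≤ w.length ∧
      v = ⟨u.pos, Function.update u.cnt l (u.cnt l + 1), u.out⟩) ∧ P w v t)
    (fun i => ⟨p i, Function.update (Function.update c k (n - i)) l i, o⟩) n
    (fun i hi => ?_) ?_
  · simpa using this
  · simp only [Function.update_of_ne hkl, Function.update_self]
    refine ⟨by simp; omega, _, ⟨by omega, by omega, rfl⟩, _, ⟨?_, rfl⟩, ?_⟩
    · simp [Function.update_of_ne hkl.symm]; omega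
    · convert hp i hi _ using 2
      simp only [Function.update_of_ne hkl.symm, Function.update_self]
      funext j
      by_cases h₁ : j = l
      · subst h₁; simp
      · by_cases h₂ : j = k
        · subst h₂; simp [h₁]; omega
        · simp [h₁, h₂]
  · simp [Function.update_of_ne hkl]

/-- Setting a counter to zero. -/
theorem clear [DecidableEq K] (k : K) : Realizes fun (w : List A) (s t : CounterState B K) =>
    s.cnt k ≤ w.length ∧ t = ⟨s.pos, Function.update s.cnt k 0, s.out⟩ := by
  refine (whileLoop (fun _ z => !z k) (dec k)).mono ?_
  rintro w s t ⟨hn, rfl⟩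
  have := WhileRel.of_steps (test := fun (_ : InputCell A) z => !z k) (w := w)
    (P := fun w (s t : CounterState B K) => (s.cnt k ≤ w.length ∧ 0 < s.cnt k ∧
      t = ⟨s.pos, Function.update s.cnt k (s.cnt k - 1), s.out⟩))
    (fun i => ⟨s.pos, Function.update s.cnt k (s.cnt k - i), s.out⟩) (s.cnt k)
    (fun i hi => ?_) ?_
  · simpa using this
  · simp only [Function.update_self, Function.update_idem]
    refine ⟨by simp; omega, by omega, by omega, ?_⟩
    congr 2
  · simp

/-- Doing nothing. -/
theorem skip : Realizes fun (_ : List A) (s t : CounterState B K) => t = s :=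
  (whileLoop (fun _ _ => false) rewind).mono fun _ _ _ h => h ▸ .done rfl

end Realizes

end

/-! ### Formulas with one kind of disjunction -/

namespace Formula

/-- Disjunction: strict if `σ` is true, lax otherwise. -/
def dis (σ : Bool) (φ ψ : Formula) : Formula := if σ then strict φ ψ else lax φ ψ

/-- Replacing every lax disjunction by the disjunction that `σ` selects. -/
def withDis (σ : Bool) : Formula → Formula
  | top => top
  | bot => bot
  | pos p => pos p
  | neg p => neg p
  | tilde φ => tilde (withDis σ φ)
  | conj φ ψ => conj (withDis σ φ) (withDis σ ψ)
  | lax φ ψ => dis σ (withDis σ φ) (withDis σ ψ)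
  | strict φ ψ => strict (withDis σ φ) (withDis σ ψ)

/-- Boolean disjunction. -/
def orB (φ ψ : Formula) : Formula := tilde (conj (tilde φ) (tilde ψ))

/-- Some subteam satisfies `φ`. -/
def sub (σ : Bool) (φ : Formula) : Formula := dis σ φ top

/-- All assignments of the team give the purely propositional formula `α` the truth value `x`.  For
`x = false` this says that no non-empty subteam satisfies `α`. -/
def lit (σ x : Bool) (α : Formula) : Formula :=
  if x then withDis σ α else tilde (sub σ (conj (tilde bot) (withDis σ α)))

/-- The conjunction of `F 0, …, F (n - 1)`. -/
def bigConj : ℕ → (ℕ → Formula) → Formula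
  | 0, _ => top
  | n + 1, F => conj (bigConj n F) (F n)

/-- The disjunction of `F 0, …, F (n - 1)`. -/
def bigDis (σ : Bool) : ℕ → (ℕ → Formula) → Formula
  | 0, _ => bot
  | n + 1, F => dis σ (bigDis σ n F) (F n)

theorem encode_tilde (φ : Formula) : (tilde φ).encode = [Letter.tilde] ++ φ.encode := rfl

theorem encode_conj (φ ψ : Formula) :
    (conj φ ψ).encode =
      [Letter.lpar] ++ (φ.encode ++ ([Letter.conj] ++ (ψ.encode ++ [Letter.rpar]))) := by
  simp [encode, tokens, Token.encode]

theorem encode_lax (φ ψ : Formula) :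
    (lax φ ψ).encode =
      [Letter.lpar] ++ (φ.encode ++ ([Letter.lax] ++ (ψ.encode ++ [Letter.rpar]))) := by
  simp [encode, tokens, Token.encode]

theorem encode_strict (φ ψ : Formula) :
    (strict φ ψ).encode =
      [Letter.lpar] ++ (φ.encode ++ ([Letter.strict] ++ (ψ.encode ++ [Letter.rpar]))) := by
  simp [encode, tokens, Token.encode]

/-- The letter of the disjunction that `σ` selects. -/
def disLetter (σ : Bool) : Letter := if σ then .strict else .lax

theorem encode_dis (σ : Bool) (φ ψ : Formula) :
    (dis σ φ ψ).encode =
      [Letter.lpar] ++ (φ.encode ++ ([disLetter σ] ++ (ψ.encode ++ [Letter.rpar]))) := by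
  cases σ
  · exact encode_lax φ ψ
  · exact encode_strict φ ψ

/-- The effect of `withDis` on the letters of a formula. -/
def withDisLetter (σ : Bool) : Letter → List Letter
  | .lax => [disLetter σ]
  | a => [a]

theorem encode_withDis (σ : Bool) (φ : Formula) :
    (withDis σ φ).encode = φ.encode.flatMap (withDisLetter σ) := by
  have digits (l : List Bool) :
      (l.map Letter.digit).flatMap (withDisLetter σ) = l.map Letter.digit := by
    induction l with
    | nil => rfl
    | cons b l ih => simpa [withDisLetter] using ih
  induction φ with
  | top | bot => rfl
  | pos p | neg p =>
    simpa [withDis, encode, tokens, Token.encode, withDisLetter] using (digits (Nat.bits p)).symm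
  | tilde φ ih => rw [withDis, encode_tilde, encode_tilde, ih, List.flatMap_append]; rfl
  | conj φ ψ ih ih' =>
    rw [withDis, encode_conj, encode_conj, ih, ih']
    simp only [List.flatMap_append]; rfl
  | lax φ ψ ih ih' =>
    rw [withDis, encode_dis, encode_lax, ih, ih']
    simp only [List.flatMap_append]; rfl
  | strict φ ψ ih ih' =>
    rw [withDis, encode_strict, encode_strict, ih, ih']
    simp only [List.flatMap_append]; rfl

theorem flatMap_range_succ_const (n : ℕ) (v : Letter) :
    (List.range (n + 1)).flatMap (fun _ => [v]) = v :: (List.range n).flatMap fun _ => [v] := by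
  rw [List.range_succ_eq_map, List.flatMap_cons, List.flatMap_map]; rfl

theorem encode_bigConj (n : ℕ) (F : ℕ → Formula) :
    (bigConj n F).encode = (List.range n).flatMap (fun _ => [Letter.lpar]) ++ ([Letter.top] ++
      (List.range n).flatMap fun i => [Letter.conj] ++ ((F i).encode ++ [Letter.rpar])) := by
  induction n with
  | zero => rfl
  | succ n ih =>
    rw [flatMap_range_succ_const, List.range_succ, List.flatMap_append, bigConj, encode_conj, ih]
    simp

theorem encode_bigDis (σ : Bool) (n : ℕ) (F : ℕ → Formula) :
    (bigDis σ n F).encode = (List.range n).flatMap (fun _ => [Letter.lpar]) ++ ([Letter.bot] ++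
      (List.range n).flatMap fun i => [disLetter σ] ++ ((F i).encode ++ [Letter.rpar])) := by
  induction n with
  | zero => rfl
  | succ n ih =>
    rw [flatMap_range_succ_const, List.range_succ, List.flatMap_append, bigDis, encode_dis, ih]
    simp

/-- Whether a letter is a separator of tuples. -/
def isSeparator : Letter → Bool
  | .comma => true
  | .semicolon => true
  | _ => false

theorem isSeparator_eq_false_of_mem_encode {φ : Formula} {a : Letter} (h : a ∈ φ.encode) :
    isSeparator a = false := by
  obtain ⟨t, -, ht⟩ := List.mem_flatMap.1 h
  cases t <;> simp only [Token.encode, List.mem_cons, List.mem_map, List.not_mem_nil,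
    or_false] at ht
  case prop => obtain rfl | ⟨b, -, rfl⟩ := ht <;> rfl
  all_goals subst ht; rfl

end Formula

namespace Tuple

/-- The entry with index `i`, and `⊤` if there is none, which is purely propositional as well. -/
def entry (a : Tuple) (i : ℕ) : Formula := (a.map fun α => α.1).getD i .top

theorem entry_eq (a : Tuple) {i : ℕ} (h : i < a.length) : a.entry i = a[i].1 := by
  simp [entry, h]

/-- The entries of a tuple as a word, without the final semicolon. -/
def encodeEntries (a : Tuple) : List Letter := a.flatMap fun α => α.1.encode ++ [.comma]

theorem encode_eq (a : Tuple) : a.encode = a.encodeEntries ++ [.semicolon] := rfl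

theorem encodeEntries_take_append_drop (a : Tuple) (i : ℕ) :
    a.encodeEntries = encodeEntries (a.take i) ++ encodeEntries (a.drop i) := by
  rw [encodeEntries, encodeEntries, encodeEntries, ← List.flatMap_append, List.take_append_drop]

theorem encodeEntries_drop (a : Tuple) {i : ℕ} (h : i < a.length) :
    encodeEntries (a.drop i) =
      (a.entry i).encode ++ .comma :: encodeEntries (a.drop (i + 1)) := by
  rw [List.drop_eq_getElem_cons h, entry_eq a h, encodeEntries, List.flatMap_cons,
    List.append_assoc]
  rfl

theorem encodeEntries_take_succ (a : Tuple) {i : ℕ} (h : i < a.length) :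
    encodeEntries (a.take (i + 1)) =
      encodeEntries (a.take i) ++ ((a.entry i).encode ++ [.comma]) := by
  rw [List.take_add_one, entry_eq a h, List.getElem?_eq_getElem h, Option.toList_some,
    encodeEntries, List.flatMap_append, List.flatMap_singleton]
  rfl

theorem length_le_length_encodeEntries (a : Tuple) : a.length ≤ a.encodeEntries.length := by
  induction a with
  | nil => exact Nat.zero_le _
  | cons α a ih =>
    simp only [encodeEntries, List.flatMap_cons, List.length_append, List.length_cons,
      List.length_nil] at ih ⊢
    omega

end Tuple

/-! ### Writing formulas in logarithmic space -/

/-- Several tuples as a word. -/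
def encodeTuples (ts : List Tuple) : List Letter := ts.flatMap Tuple.encode

/-- The text before the entry `i` of the tuple `a`, which has index `n` among `ts`. -/
def textBefore (ts : List Tuple) (n : ℕ) (a : Tuple) (i : ℕ) : List Letter :=
  encodeTuples (ts.take n) ++ Tuple.encodeEntries (a.take i)

theorem encodeTuples_eq {ts : List Tuple} {n : ℕ} {a : Tuple} (h : ts[n]? = some a) :
    encodeTuples ts =
      encodeTuples (ts.take n) ++ (a.encode ++ encodeTuples (ts.drop (n + 1))) := by
  obtain ⟨hn, rfl⟩ := List.getElem?_eq_some_iff.1 h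
  conv_lhs => rw [← List.take_append_drop n ts, List.drop_eq_getElem_cons hn]
  rw [encodeTuples, List.flatMap_append, List.flatMap_cons]
  rfl

theorem encodeTuples_eq_of_lt {ts : List Tuple} {n : ℕ} {a : Tuple} (h : ts[n]? = some a) {i : ℕ}
    (hi : i < a.length) : ∃ post, encodeTuples ts =
      textBefore ts n a i ++ ((a.entry i).encode ++ .comma :: post) := by
  refine ⟨Tuple.encodeEntries (a.drop (i + 1)) ++
    ([.semicolon] ++ encodeTuples (ts.drop (n + 1))), ?_⟩
  rw [encodeTuples_eq h, Tuple.encode_eq, a.encodeEntries_take_append_drop i,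
    a.encodeEntries_drop hi]
  simp only [textBefore, List.append_assoc, List.cons_append]

theorem encodeTuples_eq_of_length {ts : List Tuple} {n : ℕ} {a : Tuple} (h : ts[n]? = some a) :
    ∃ post, encodeTuples ts = textBefore ts n a a.length ++ .semicolon :: post := by
  refine ⟨encodeTuples (ts.drop (n + 1)), ?_⟩
  rw [encodeTuples_eq h, Tuple.encode_eq]
  simp only [textBefore, List.append_assoc, List.take_length, List.cons_append, List.nil_append]

theorem textBefore_succ (ts : List Tuple) (n : ℕ) (a : Tuple) {i : ℕ} (hi : i < a.length) :
    textBefore ts n a (i + 1) = textBefore ts n a i ++ ((a.entry i).encode ++ [.comma]) := by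
  rw [textBefore, a.encodeEntries_take_succ hi, textBefore, List.append_assoc]

theorem length_textBefore_le {ts : List Tuple} {n : ℕ} {a : Tuple} (h : ts[n]? = some a) {i : ℕ}
    (hi : i ≤ a.length) : (textBefore ts n a i).length ≤ (encodeTuples ts).length := by
  rcases hi.lt_or_eq with hi | rfl
  · obtain ⟨post, hp⟩ := encodeTuples_eq_of_lt h hi
    simp [hp]
  · obtain ⟨post, hp⟩ := encodeTuples_eq_of_length h
    simp [hp]

theorem length_le_length_encodeTuples {ts : List Tuple} {n : ℕ} {a : Tuple}
    (h : ts[n]? = some a) : a.length ≤ (encodeTuples ts).length := by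
  refine a.length_le_length_encodeEntries.trans ?_
  simp [encodeTuples_eq h, Tuple.encode_eq]
  omega

/-- Three counters for the indices of nested loops, and an auxiliary counter that is zero. -/
def loopCounters (e : Fin 3 → ℕ) : Option (Fin 3) → ℕ := fun k => k.elim 0 e

theorem loopCounters_update (e : Fin 3 → ℕ) (k : Fin 3) (i : ℕ) :
    Function.update (loopCounters e) (some k) i = loopCounters (Function.update e k i) := by
  funext j
  rcases j with _ | j
  · simp [loopCounters]
  · by_cases h : j = k
    · subst h; simp [loopCounters]
    · simp [loopCounters, h]

/-- Whether a letter is a comma. -/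
def Letter.isComma : Letter → Bool
  | .comma => true
  | _ => false

/-- Whether a letter is a semicolon. -/
def Letter.isSemicolon : Letter → Bool
  | .semicolon => true
  | _ => false

theorem Letter.isComma_eq_false {a : Letter} (h : Formula.isSeparator a = false) :
    a.isComma = false := by
  cases a <;> simp_all [Formula.isSeparator, Letter.isComma]

theorem isSemicolon_eq_false_of_mem_encodeEntries {a : Tuple} {l : Letter}
    (h : l ∈ a.encodeEntries) : l.isSemicolon = false := by
  obtain ⟨α, -, hα⟩ := List.mem_flatMap.1 h
  rcases List.mem_append.1 hα with h | h
  · have := Formula.isSeparator_eq_false_of_mem_encode h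
    cases l <;> simp_all [Formula.isSeparator, Letter.isSemicolon]
  · rw [List.mem_singleton.1 h]; rfl

namespace Realizes

/-- Moving from the left end to the beginning of the tuple with index `n`. -/
theorem seekTuple {K : Type} (n : ℕ) :
    Realizes fun w (s t : CounterState Letter K) => ∃ ts : List Tuple, n < ts.length ∧
      w = encodeTuples ts ∧ s.pos = 0 ∧
      t = ⟨(encodeTuples (ts.take n)).length + 1, s.cnt, s.out⟩ := by
  induction n with
  | zero =>
    refine (inputStep .right fun _ => []).mono ?_
    rintro w s t ⟨ts, -, -, hs, rfl⟩
    simp [hs, moveHead, encodeTuples]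
  | succ n ih =>
    refine (ih.seq ((scan Letter.isSemicolon fun _ => []).seq
      (inputStep .right fun _ => []))).mono ?_
    rintro w s t ⟨ts, hn, rfl, hs, rfl⟩
    have h : ts[n]? = some ts[n] := List.getElem?_eq_getElem (by omega)
    have hw : encodeTuples ts = encodeTuples (ts.take n) ++ (ts[n].encodeEntries ++
        .semicolon :: encodeTuples (ts.drop (n + 1))) := by
      rw [encodeTuples_eq h, Tuple.encode_eq]; simp
    refine ⟨_, ⟨ts, by omega, rfl, hs, rfl⟩, _, ⟨encodeTuples (ts.take n), ts[n].encodeEntries,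
      .semicolon, _, hw, fun l => isSemicolon_eq_false_of_mem_encodeEntries, rfl, rfl, rfl⟩, ?_⟩
    refine CounterState.ext ?_ rfl (by simp)
    have : encodeTuples (ts.take (n + 1)) =
        encodeTuples (ts.take n) ++ (ts[n].encodeEntries ++ [.semicolon]) := by
      rw [List.take_add_one, h, Option.toList_some, encodeTuples, List.flatMap_append,
        List.flatMap_singleton]
      rfl
    rw [this, hw]
    simp [moveHead]
    omega

/-- Moving from the left end to the entry of the tuple with index `n` to which the counter `k`
points, or behind the last entry.  The auxiliary counter holds the value of `k` for a while. -/
theorem seekEntry (k : Fin 3) (n : ℕ) :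
    Realizes fun w (s t : CounterState Letter (Option (Fin 3))) => ∃ ts a e o,
      w = encodeTuples ts ∧ ts[n]? = some a ∧ e k ≤ a.length ∧ s = ⟨0, loopCounters e, o⟩ ∧
      t = ⟨(textBefore ts n a (e k)).length + 1, loopCounters e, o⟩ := by
  have nextEntry := (scan (B := Letter) (K := Option (Fin 3)) Letter.isComma fun _ => []).seq
    (inputStep .right fun _ => [])
  -- Each unit of `k` is moved to the auxiliary counter while one entry is skipped; then the value
  -- is moved back.
  refine ((seekTuple n).seq ((transfer (k := some k) (l := none) (by simp) nextEntry).seq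
    (transfer (k := none) (l := some k) (by simp) skip))).mono ?_
  rintro w s t ⟨ts, a, e, o, rfl, h, hk, rfl, rfl⟩
  have hlen : e k ≤ (encodeTuples ts).length := hk.trans (length_le_length_encodeTuples h)
  refine ⟨_, ⟨ts, (List.getElem?_eq_some_iff.1 h).1, rfl, rfl, rfl⟩, _,
    ⟨loopCounters e, e k, fun i => (textBefore ts n a i).length + 1, o, hlen, fun i hi c => ?_,
      ?_, rfl⟩, loopCounters e, e k, fun _ => (textBefore ts n a (e k)).length + 1, o, hlen,
      fun _ _ _ => rfl, ?_, ?_⟩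
  · have hia : i < a.length := by omega
    obtain ⟨post, hp⟩ := encodeTuples_eq_of_lt h hia
    refine ⟨_, ⟨textBefore ts n a i, (a.entry i).encode, .comma, post, hp,
      fun l hl => Letter.isComma_eq_false (Formula.isSeparator_eq_false_of_mem_encode hl), rfl, rfl,
      rfl⟩, ?_⟩
    refine CounterState.ext ?_ rfl (by simp)
    simp only [moveHead, textBefore_succ ts n a hia, hp, List.length_append, List.length_cons,
      List.length_nil]
    omega
  · refine CounterState.ext (by simp [textBefore, Tuple.encodeEntries]) ?_ rfl
    funext j
    rcases j with _ | j
    · simp [loopCounters]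
    · by_cases hj : j = k
      · subst hj; simp [loopCounters]
      · simp [loopCounters, hj]
  · refine CounterState.ext rfl ?_ rfl
    simp only
    rw [Function.update_comm (by simp)]
  · refine CounterState.ext rfl ?_ rfl
    funext j
    rcases j with _ | j
    · simp [loopCounters]
    · by_cases hj : j = k
      · subst hj; simp [loopCounters]
      · simp [loopCounters, hj]

end Realizes

/-- Some routine, given the tuples `ts x` on the input tape and the loop indices `e x` in its
counters, appends the word `f x` to the output, for all `x` with `P x`. -/
def Writes {X : Type} (P : X → Prop) (ts : X → List Tuple) (e : X → Fin 3 → ℕ)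
    (f : X → List Letter) : Prop :=
  Realizes fun w (s t : CounterState Letter (Option (Fin 3))) => ∃ x o, P x ∧
    w = encodeTuples (ts x) ∧ s = ⟨0, loopCounters (e x), o⟩ ∧
    t = ⟨0, loopCounters (e x), o ++ f x⟩

namespace Writes

variable {X : Type} {P : X → Prop} {ts : X → List Tuple} {e : X → Fin 3 → ℕ}

theorem const (v : List Letter) : Writes P ts e fun _ => v := by
  refine (Realizes.inputStep .stay fun _ => v).mono ?_
  rintro w s t ⟨x, o, -, rfl, rfl, rfl⟩
  simp [moveHead]

theorem append {f g : X → List Letter} (hf : Writes P ts e f) (hg : Writes P ts e g) :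
    Writes P ts e fun x => f x ++ g x := by
  refine (Realizes.seq hf hg).mono ?_
  rintro w s t ⟨x, o, hx, rfl, rfl, rfl⟩
  exact ⟨_, ⟨x, o, hx, rfl, rfl, rfl⟩, x, _, hx, rfl, rfl, by rw [List.append_assoc]⟩

/-- The entry of the tuple with index `n` to which the loop index `k` points can be written. -/
theorem entry (σ : Bool) (k : Fin 3) (n : ℕ) {a : X → Tuple} {i : X → ℕ}
    (h : ∀ x, P x → (ts x)[n]? = some (a x) ∧ e x k = i x ∧ i x < (a x).length) :
    Writes P ts e fun x => (Formula.withDis σ ((a x).entry (i x))).encode := by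
  refine ((Realizes.seekEntry k n).seq ((Realizes.scan Letter.isComma
    (Formula.withDisLetter σ)).seq Realizes.rewind)).mono ?_
  rintro w s t ⟨x, o, hx, rfl, rfl, rfl⟩
  obtain ⟨h₁, h₂, h₃⟩ := h x hx
  obtain ⟨post, hp⟩ := encodeTuples_eq_of_lt h₁ h₃
  refine ⟨_, ⟨ts x, a x, e x, o, rfl, h₁, by omega, rfl, rfl⟩, _,
    ⟨textBefore (ts x) n (a x) (i x), ((a x).entry (i x)).encode, .comma, post, hp,
      fun l hl => Letter.isComma_eq_false (Formula.isSeparator_eq_false_of_mem_encode hl), rfl,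
      by rw [h₂], rfl⟩, ?_, ?_⟩
  · simp [hp]
  · simp only [Formula.encode_withDis]

/-- A loop over the entries of the tuple with index `n`, with loop index `k`. -/
theorem loop (k : Fin 3) (n : ℕ) {a : X → Tuple} {f : X → ℕ → List Letter}
    (h : ∀ x, P x → (ts x)[n]? = some (a x) ∧ e x k = 0)
    (hf : Writes (X := X × ℕ) (fun y => P y.1 ∧ y.2 < (a y.1).length) (fun y => ts y.1)
      (fun y => Function.update (e y.1) k y.2) fun y => f y.1 y.2) :
    Writes P ts e fun x => (List.range (a x).length).flatMap (f x) := by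
  have body := Realizes.rewind.seq (Realizes.seq hf
    ((Realizes.inc (some k)).seq (Realizes.seekEntry k n)))
  -- The search for entry `k` ends on a semicolon exactly when `k` is the number of entries.
  refine ((Realizes.seekEntry k n).seq ((Realizes.whileLoop
    (fun c _ => c.passes Letter.isSemicolon) body).seq
    (Realizes.rewind.seq (Realizes.clear (some k))))).mono ?_
  rintro w s t ⟨x, o, hx, rfl, rfl, rfl⟩
  obtain ⟨h₁, h₂⟩ := h x hx
  have hlen := length_le_length_encodeTuples h₁
  let st : ℕ → CounterState Letter (Option (Fin 3)) := fun i =>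
    ⟨(textBefore (ts x) n (a x) i).length + 1, loopCounters (Function.update (e x) k i),
      o ++ (List.range i).flatMap (f x)⟩
  refine ⟨st 0, ⟨ts x, a x, e x, o, rfl, h₁, by omega, rfl, ?_⟩, st (a x).length,
    WhileRel.of_steps st _ (fun i hi => ⟨?_, ?_⟩) ?_, _, ⟨?_, rfl⟩, ?_, ?_⟩
  · simp only [st, ← h₂, Function.update_eq_self]
    simp [h₂]
  · obtain ⟨post, hp⟩ := encodeTuples_eq_of_lt h₁ hi
    obtain ⟨c, u, hu⟩ : ∃ c u, ((a x).entry i).encode ++ Letter.comma :: post = c :: u :=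
      List.exists_cons_of_ne_nil (by simp)
    have hc : c.isSemicolon = false := by
      have hc : c ∈ ((a x).entry i).encode ++ [Letter.comma] := by
        cases hh : ((a x).entry i).encode <;> simp_all
      rw [Tuple.entry_eq _ hi] at hc
      exact isSemicolon_eq_false_of_mem_encodeEntries (a := a x)
        (List.mem_flatMap.2 ⟨_, List.getElem_mem hi, hc⟩)
    rw [hu] at hp
    simp only [st, hp, readInput_append_cons, InputCell.passes, hc]
    rfl
  · refine ⟨_, ⟨?_, rfl⟩, _, ⟨(x, i), (st i).out, ⟨hx, hi⟩, rfl, rfl, rfl⟩, _,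
      ⟨?_, rfl⟩, ts x, a x, Function.update (e x) k (i + 1), (st i).out ++ f x i, rfl, h₁,
      ?_, ?_, ?_⟩
    · simpa [st] using length_textBefore_le h₁ hi.le
    · simp [loopCounters]; omega
    · simpa using hi
    · refine CounterState.ext rfl ?_ rfl
      simp only
      rw [loopCounters_update]
      simp [loopCounters]
    · refine CounterState.ext ?_ rfl ?_
      · simp [st]
      · simp [st, List.range_succ]
  · obtain ⟨post, hp⟩ := encodeTuples_eq_of_length h₁
    simp only [st, hp, readInput_append_cons, InputCell.passes]
    rfl
  · simpa [st] using length_textBefore_le h₁ le_rfl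
  · simpa [st, loopCounters] using hlen
  · refine CounterState.ext rfl ?_ rfl
    simp only [st]
    rw [loopCounters_update, Function.update_idem, ← h₂, Function.update_eq_self]

end Writes

theorem LogspaceComputable.of_writes {X : Type} {ts : X → List Tuple} {f : X → List Letter}
    (h : Writes (fun _ => True) ts (fun _ _ => 0) f) :
    LogspaceComputable (fun x => encodeTuples (ts x)) f := by
  refine LogspaceComputable.of_realizes h fun x => ⟨0, loopCounters fun _ => 0, x, [], trivial, rfl,
    ?_, rfl⟩
  congr 1
  funext k
  cases k <;> rfl

/-! ### The defining formulas -/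

namespace Formula

/-- The conjunction over both truth values. -/
def bothValues (F : Bool → Formula) : Formula := conj (F true) (F false)

/-- The truth value of `α` is constant on the team. -/
def isConst (σ : Bool) (α : Formula) : Formula := orB (lit σ true α) (lit σ false α)

/-- The truth values of all entries of `a` are constant on the team. -/
def constAll (σ : Bool) (a : Tuple) : Formula := bigConj a.length fun i => isConst σ (a.entry i)

/-- Both truth values of `α` occur in the team. -/
def hasBoth (σ : Bool) (α : Formula) : Formula :=
  conj (tilde (lit σ true α)) (tilde (lit σ false α))

/-- The assignments `s` with truth value `x` of `μ`, and the assignments `s'` with the other truth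
value of `μ`, exist and satisfy `s(a) = s'(b)`. -/
def crossMatch (σ x : Bool) (μ : Formula) (a b : Tuple) : Formula :=
  conj (hasBoth σ μ) (bigConj a.length fun i =>
    orB (dis σ (conj (lit σ x μ) (lit σ true (a.entry i)))
        (conj (lit σ (!x) μ) (lit σ true (b.entry i))))
      (dis σ (conj (lit σ x μ) (lit σ false (a.entry i)))
        (conj (lit σ (!x) μ) (lit σ false (b.entry i)))))

/-- All assignments give `α` and `β` the same truth value. -/
def agree (σ : Bool) (α β : Formula) : Formula :=
  dis σ (conj (lit σ true α) (lit σ true β)) (conj (lit σ false α) (lit σ false β))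

/-- No subteam on which `a` is constant is one on which `b` is not. -/
def depFormula (σ : Bool) (a b : Tuple) : Formula :=
  tilde (sub σ (conj (constAll σ a) (tilde (constAll σ b))))

/-- No assignment has `s(a) = s(b)`, and no two assignments `s`, `s'` that differ on an entry of
`a` have `s(a) = s'(b)`. -/
def exclFormula (σ : Bool) (a b : Tuple) : Formula :=
  conj (tilde (sub σ (conj (tilde bot)
      (bigConj a.length fun i => agree σ (a.entry i) (b.entry i)))))
    (bigConj a.length fun j => bothValues fun x =>
      tilde (sub σ (crossMatch σ x (a.entry j) a b)))

/-- For every index `j` and truth value `x`: after the removal of arbitrary assignments with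
`s(bⱼ) ≠ x`, if some of these are left and all that are left have `s(aⱼ) = x`, then
`s(a) = s'(b)` for one of these and some `s'` with `s'(bⱼ) = x`. -/
def inclFormula (σ : Bool) (a b : Tuple) : Formula :=
  bigConj a.length fun j => bothValues fun x =>
    tilde (dis σ (conj (dis σ (lit σ x (b.entry j)) (lit σ x (a.entry j)))
      (conj (tilde (lit σ x (b.entry j)))
        (tilde (sub σ (crossMatch σ (!x) (b.entry j) a b)))))
      (lit σ (!x) (b.entry j)))

/-- The anonymity atom for the tuple `a` and a single formula `β`. -/
def anonSingle (σ : Bool) (a : Tuple) (β : Formula) : Formula :=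
  bothValues fun x =>
    tilde (dis σ (conj (tilde (lit σ x β)) (tilde (sub σ (conj (hasBoth σ β) (constAll σ a)))))
      (lit σ (!x) β))

/-- The team splits into teams each of which satisfies the atom for one entry of `b`. -/
def anonFormula (σ : Bool) (a b : Tuple) : Formula :=
  bigDis σ b.length fun j => anonSingle σ a (b.entry j)

/-- Every assignment has `s(α) = x` or `s(β) = y`. -/
def corner (σ x : Bool) (α : Formula) (y : Bool) (β : Formula) : Formula :=
  dis σ (lit σ x α) (lit σ y β)

/-- The part of the conditional independence atom for assignments `s`, `s'` with `s(α) = x`,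
`s(β) = y`, `s'(α) ≠ x`, `s'(β) ≠ y`.  The assignments `s''` that are looked for have `s''(α) = x`
and `s''(β) ≠ y`; therefore the three kinds can be told apart in any subteam. -/
def indepCorner (σ : Bool) (a b c : Tuple) (α β : Formula) (x y : Bool) : Formula :=
  tilde (dis σ (conj (conj (tilde (corner σ (!x) α (!y) β)) (tilde (corner σ x α y β)))
      (conj (dis σ (constAll σ c) (conj (lit σ x α) (lit σ (!y) β)))
        (tilde (sub σ (conj
          (conj (tilde (corner σ (!x) α (!y) β))
            (conj (tilde (corner σ x α y β)) (tilde (corner σ (!x) α y β))))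
          (conj (constAll σ c)
            (conj (dis σ (constAll σ a) (lit σ (!x) α))
              (dis σ (constAll σ b) (lit σ y β)))))))))
    (corner σ (!x) α y β))

/-- The conjunction of the parts for all pairs of entries of `a` and `b` and all truth values. -/
def indepFormula (σ : Bool) (a b c : Tuple) : Formula :=
  bigConj a.length fun j => bigConj b.length fun l => bothValues fun x => bothValues fun y =>
    indepCorner σ a b c (a.entry j) (b.entry l) x y

end Formula

/-! ### Writing the defining formulas -/

open Formula

namespace Writes

variable {X : Type} {P : X → Prop} {ts : X → List Tuple} {e : X → Fin 3 → ℕ} {σ : Bool}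
  {F G : X → Formula}

theorem tilde (hF : Writes P ts e fun x => (F x).encode) :
    Writes P ts e fun x => (Formula.tilde (F x)).encode :=
  (const [.tilde]).append hF

theorem conj (hF : Writes P ts e fun x => (F x).encode)
    (hG : Writes P ts e fun x => (G x).encode) :
    Writes P ts e fun x => (Formula.conj (F x) (G x)).encode := by
  simp only [encode_conj]
  exact (const _).append (hF.append ((const _).append (hG.append (const _))))

theorem dis (hF : Writes P ts e fun x => (F x).encode)
    (hG : Writes P ts e fun x => (G x).encode) :
    Writes P ts e fun x => (Formula.dis σ (F x) (G x)).encode := by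
  simp only [encode_dis]
  exact (const _).append (hF.append ((const _).append (hG.append (const _))))

theorem orB (hF : Writes P ts e fun x => (F x).encode)
    (hG : Writes P ts e fun x => (G x).encode) :
    Writes P ts e fun x => (Formula.orB (F x) (G x)).encode :=
  (hF.tilde.conj hG.tilde).tilde

theorem sub (hF : Writes P ts e fun x => (F x).encode) :
    Writes P ts e fun x => (Formula.sub σ (F x)).encode :=
  hF.dis (const _)

theorem bothValues {F : X → Bool → Formula} (hF : ∀ b, Writes P ts e fun x => (F x b).encode) :
    Writes P ts e fun x => (Formula.bothValues (F x)).encode :=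
  (hF true).conj (hF false)

theorem bigConj (k : Fin 3) (n : ℕ) (a : X → Tuple) {F : X → ℕ → Formula}
    (h : ∀ x, P x → (ts x)[n]? = some (a x) ∧ e x k = 0)
    (hF : Writes (X := X × ℕ) (fun y => P y.1 ∧ y.2 < (a y.1).length) (fun y => ts y.1)
      (fun y => Function.update (e y.1) k y.2) fun y => (F y.1 y.2).encode) :
    Writes P ts e fun x => (Formula.bigConj (a x).length (F x)).encode := by
  simp only [encode_bigConj]
  exact (loop k n h (const _)).append ((const _).append
    (loop k n h ((const _).append (hF.append (const _)))))

theorem bigDis (k : Fin 3) (n : ℕ) (a : X → Tuple) {F : X → ℕ → Formula}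
    (h : ∀ x, P x → (ts x)[n]? = some (a x) ∧ e x k = 0)
    (hF : Writes (X := X × ℕ) (fun y => P y.1 ∧ y.2 < (a y.1).length) (fun y => ts y.1)
      (fun y => Function.update (e y.1) k y.2) fun y => (F y.1 y.2).encode) :
    Writes P ts e fun x => (Formula.bigDis σ (a x).length (F x)).encode := by
  simp only [encode_bigDis]
  exact (loop k n h (const _)).append ((const _).append
    (loop k n h ((const _).append (hF.append (const _)))))

theorem lit {b : Bool} {k : Fin 3} {n : ℕ} {a : X → Tuple} {i : X → ℕ}
    (h : ∀ x, P x → (ts x)[n]? = some (a x) ∧ e x k = i x ∧ i x < (a x).length) :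
    Writes P ts e fun x => (Formula.lit σ b ((a x).entry (i x))).encode := by
  have := entry σ k n h
  cases b
  · exact (((const (Formula.bot.tilde).encode).conj this).sub).tilde
  · exact this

theorem isConst {k : Fin 3} {n : ℕ} {a : X → Tuple} {i : X → ℕ}
    (h : ∀ x, P x → (ts x)[n]? = some (a x) ∧ e x k = i x ∧ i x < (a x).length) :
    Writes P ts e fun x => (Formula.isConst σ ((a x).entry (i x))).encode :=
  (lit h).orB (lit h)

theorem constAll {n : ℕ} {a : X → Tuple} (h : ∀ x, P x → (ts x)[n]? = some (a x) ∧ e x 2 = 0) :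
    Writes P ts e fun x => (Formula.constAll σ (a x)).encode := by
  refine bigConj 2 n a h (F := fun x i => Formula.isConst σ ((a x).entry i)) ?_
  exact isConst (P := fun y : X × ℕ => P y.1 ∧ y.2 < (a y.1).length) (ts := fun y => ts y.1)
    (e := fun y => Function.update (e y.1) 2 y.2) (k := 2) (n := n) (a := fun y => a y.1)
    (i := fun y => y.2) fun y hy => ⟨(h y.1 hy.1).1, by simp, hy.2⟩

theorem hasBoth {k : Fin 3} {n : ℕ} {a : X → Tuple} {i : X → ℕ}
    (h : ∀ x, P x → (ts x)[n]? = some (a x) ∧ e x k = i x ∧ i x < (a x).length) :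
    Writes P ts e fun x => (Formula.hasBoth σ ((a x).entry (i x))).encode :=
  (lit h).tilde.conj (lit h).tilde

theorem agree {k l : Fin 3} {m n : ℕ} {a b : X → Tuple} {i j : X → ℕ}
    (h : ∀ x, P x → (ts x)[m]? = some (a x) ∧ e x k = i x ∧ i x < (a x).length)
    (h' : ∀ x, P x → (ts x)[n]? = some (b x) ∧ e x l = j x ∧ j x < (b x).length) :
    Writes P ts e fun x => (Formula.agree σ ((a x).entry (i x)) ((b x).entry (j x))).encode :=
  ((lit h).conj (lit h')).dis ((lit h).conj (lit h'))

theorem crossMatch {x : Bool} {k : Fin 3} {m n r : ℕ} {a b c : X → Tuple} {j : X → ℕ}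
    (hk : k ≠ 2) (h₀ : ∀ x, P x → e x 2 = 0)
    (ha : ∀ x, P x → (ts x)[m]? = some (a x)) (hb : ∀ x, P x → (ts x)[n]? = some (b x))
    (hab : ∀ x, P x → (a x).length = (b x).length)
    (hc : ∀ x, P x → (ts x)[r]? = some (c x) ∧ e x k = j x ∧ j x < (c x).length) :
    Writes P ts e fun y =>
      (Formula.crossMatch σ x ((c y).entry (j y)) (a y) (b y)).encode := by
  refine (hasBoth hc).conj (bigConj 2 m a (fun x hx => ⟨ha x hx, h₀ x hx⟩) ?_)
  have hμ (z : Bool) := lit (σ := σ) (b := z) (k := k) (n := r)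
    (P := fun y : X × ℕ => P y.1 ∧ y.2 < (a y.1).length)
    (ts := fun y => ts y.1) (e := fun y => Function.update (e y.1) 2 y.2)
    (a := fun y => c y.1) (i := fun y => j y.1) fun y hy => by simpa [hk] using hc y.1 hy.1
  have hα (z : Bool) := lit (σ := σ) (b := z) (k := 2) (n := m)
    (P := fun y : X × ℕ => P y.1 ∧ y.2 < (a y.1).length)
    (ts := fun y => ts y.1) (e := fun y => Function.update (e y.1) 2 y.2)
    (a := fun y => a y.1) (i := fun y => y.2) fun y hy => ⟨ha y.1 hy.1, by simp, hy.2⟩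
  have hβ (z : Bool) := lit (σ := σ) (b := z) (k := 2) (n := n)
    (P := fun y : X × ℕ => P y.1 ∧ y.2 < (a y.1).length)
    (ts := fun y => ts y.1) (e := fun y => Function.update (e y.1) 2 y.2)
    (a := fun y => b y.1) (i := fun y => y.2)
    fun y hy => ⟨hb y.1 hy.1, by simp, hab y.1 hy.1 ▸ hy.2⟩
  exact (((hμ x).conj (hα true)).dis ((hμ !x).conj (hβ true))).orB
    (((hμ x).conj (hα false)).dis ((hμ !x).conj (hβ false)))

theorem depFormula : Writes (X := Tuple × Tuple) (fun _ => True) (fun x => [x.1, x.2])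
    (fun _ _ => 0) fun x => (Formula.depFormula σ x.1 x.2).encode :=
  ((constAll (n := 0) (a := fun x : Tuple × Tuple => x.1) (by simp)).conj
    (constAll (n := 1) (a := fun x : Tuple × Tuple => x.2) (by simp)).tilde).sub.tilde

theorem exclFormula : Writes (X := {x : Tuple × Tuple // x.1.length = x.2.length})
    (fun _ => True) (fun x => [x.1.1, x.1.2])
    (fun _ _ => 0) fun x => (Formula.exclFormula σ x.1.1 x.1.2).encode := by
  have hα : ∀ y : {x : Tuple × Tuple // x.1.length = x.2.length} × ℕ,
      True ∧ y.2 < y.1.1.1.length → [y.1.1.1, y.1.1.2][0]? = some y.1.1.1 ∧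
        Function.update (fun _ : Fin 3 => 0) 0 y.2 0 = y.2 ∧ y.2 < y.1.1.1.length :=
    fun y hy => by simpa using hy.2
  have hβ : ∀ y : {x : Tuple × Tuple // x.1.length = x.2.length} × ℕ,
      True ∧ y.2 < y.1.1.1.length → [y.1.1.1, y.1.1.2][1]? = some y.1.1.2 ∧
        Function.update (fun _ : Fin 3 => 0) 0 y.2 0 = y.2 ∧ y.2 < y.1.1.2.length :=
    fun y hy => by simpa using y.1.2 ▸ hy.2
  simp only [Formula.exclFormula]
  refine ((const (Formula.bot.tilde).encode).conj
    (bigConj 0 0 (fun x : {x : Tuple × Tuple // x.1.length = x.2.length} => x.1.1)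
      (by simp) ?_)).sub.tilde.conj
    (bigConj 0 0 (fun x : {x : Tuple × Tuple // x.1.length = x.2.length} => x.1.1)
      (by simp) (bothValues fun x =>
      (crossMatch (k := 0) (m := 0) (n := 1) (r := 0) (by simp) (by simp) (by simp) (by simp)
        (fun y _ => y.1.2) hα).sub.tilde))
  exact agree (k := 0) (l := 0) (m := 0) (n := 1) hα hβ

theorem inclFormula : Writes (X := {x : Tuple × Tuple // x.1.length = x.2.length})
    (fun _ => True) (fun x => [x.1.1, x.1.2])
    (fun _ _ => 0) fun x => (Formula.inclFormula σ x.1.1 x.1.2).encode := by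
  let X := {x : Tuple × Tuple // x.1.length = x.2.length}
  simp only [Formula.inclFormula]
  refine bigConj 0 0 (fun x : {x : Tuple × Tuple // x.1.length = x.2.length} => x.1.1)
      (by simp) (bothValues fun x => ?_)
  have hα (z : Bool) := lit (σ := σ) (b := z) (k := 0) (n := 0)
    (P := fun y : X × ℕ => True ∧ y.2 < y.1.1.1.length) (ts := fun y => [y.1.1.1, y.1.1.2])
    (e := fun y => Function.update (fun _ => 0) 0 y.2) (a := fun y => y.1.1.1) (i := fun y => y.2)
    fun y hy => by simpa using hy.2
  have hβ' : ∀ y : X × ℕ, True ∧ y.2 < y.1.1.1.length →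
      [y.1.1.1, y.1.1.2][1]? = some y.1.1.2 ∧
        Function.update (fun _ : Fin 3 => 0) 0 y.2 0 = y.2 ∧ y.2 < y.1.1.2.length :=
    fun y hy => by simpa using y.1.2 ▸ hy.2
  have hβ (z : Bool) := lit (σ := σ) (b := z) (k := 0) (n := 1)
    (P := fun y : X × ℕ => True ∧ y.2 < y.1.1.1.length) (ts := fun y => [y.1.1.1, y.1.1.2])
    (e := fun y => Function.update (fun _ => 0) 0 y.2) (a := fun y => y.1.1.2) (i := fun y => y.2)
    hβ'
  exact ((((hβ x).dis (hα x)).conj ((hβ x).tilde.conj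
    (crossMatch (k := 0) (m := 0) (n := 1) (r := 1) (by simp) (by simp) (by simp) (by simp)
      (fun y _ => y.1.2) hβ').sub.tilde)).dis (hβ _)).tilde

theorem anonFormula : Writes (X := Tuple × Tuple) (fun _ => True) (fun x => [x.1, x.2])
    (fun _ _ => 0) fun x => (Formula.anonFormula σ x.1 x.2).encode := by
  simp only [Formula.anonFormula]
  refine bigDis 0 1 (fun x : Tuple × Tuple => x.2) (by simp) (bothValues fun x => ?_)
  have hβ' : ∀ y : (Tuple × Tuple) × ℕ, True ∧ y.2 < y.1.2.length →
      [y.1.1, y.1.2][1]? = some y.1.2 ∧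
        Function.update (fun _ : Fin 3 => 0) 0 y.2 0 = y.2 ∧ y.2 < y.1.2.length :=
    fun y hy => by simpa using hy.2
  have ha := constAll (σ := σ) (n := 0)
    (P := fun y : (Tuple × Tuple) × ℕ => True ∧ y.2 < y.1.2.length)
    (ts := fun y => [y.1.1, y.1.2]) (e := fun y => Function.update (fun _ => 0) 0 y.2)
    (a := fun y => y.1.1) (by simp)
  exact (((lit hβ').tilde.conj ((hasBoth hβ').conj ha).sub.tilde).dis (lit hβ')).tilde

theorem indepFormula : Writes (X := Tuple × Tuple × Tuple) (fun _ => True)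
    (fun x => [x.1, x.2.1, x.2.2]) (fun _ _ => 0)
    fun x => (Formula.indepFormula σ x.1 x.2.1 x.2.2).encode := by
  let X := ((Tuple × Tuple × Tuple) × ℕ) × ℕ
  let P : X → Prop :=
    fun y => (True ∧ y.1.2 < y.1.1.1.length) ∧ y.2 < y.1.1.2.1.length
  let ts : X → List Tuple :=
    fun y => [y.1.1.1, y.1.1.2.1, y.1.1.2.2]
  let e : X → Fin 3 → ℕ :=
    fun y => Function.update (Function.update (fun _ => 0) 0 y.1.2) 1 y.2
  simp only [Formula.indepFormula]
  refine bigConj 0 0 (fun x : Tuple × Tuple × Tuple => x.1) (by simp)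
    (bigConj 1 1 (fun y : (Tuple × Tuple × Tuple) × ℕ => y.1.2.1) (by simp)
    (bothValues fun x => bothValues fun y => ?_))
  have hα (z : Bool) : Writes P ts e fun y =>
      (Formula.lit σ z (y.1.1.1.entry y.1.2)).encode :=
    lit (k := 0) (n := 0) (a := fun y : X => y.1.1.1) (i := fun y : X => y.1.2)
      fun y hy => by simpa [ts, e] using hy.1.2
  have hβ (z : Bool) : Writes P ts e fun y =>
      (Formula.lit σ z (y.1.1.2.1.entry y.2)).encode :=
    lit (k := 1) (n := 1) (a := fun y : X => y.1.1.2.1) (i := fun y : X => y.2)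
      fun y hy => by simpa [ts, e] using hy.2
  have ha : Writes P ts e fun y => (Formula.constAll σ y.1.1.1).encode :=
    constAll (n := 0) (by simp [ts, e])
  have hb : Writes P ts e fun y => (Formula.constAll σ y.1.1.2.1).encode :=
    constAll (n := 1) (by simp [ts, e])
  have hc : Writes P ts e fun y => (Formula.constAll σ y.1.1.2.2).encode :=
    constAll (n := 2) (by simp [ts, e])
  have hcorner (u v : Bool) : Writes P ts e fun y =>
      (Formula.corner σ u (y.1.1.1.entry y.1.2) v (y.1.1.2.1.entry y.2)).encode :=
    (hα u).dis (hβ v)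
  exact ((((hcorner _ _).tilde.conj (hcorner _ _).tilde).conj
    ((hc.dis ((hα _).conj (hβ _))).conj
      (((hcorner _ _).tilde.conj ((hcorner _ _).tilde.conj (hcorner _ _).tilde)).conj
        (hc.conj ((ha.dis (hα _)).conj (hb.dis (hβ _))))).sub.tilde)).dis (hcorner _ _)).tilde

end Writes

/-! ### Semantics of the building blocks -/

/-- Purely propositional formulas, as a predicate. -/
def Formula.IsPure (α : Formula) : Prop :=
  α.PL {Connective.conj, Connective.lax} ∧ α.TildeFree

theorem Tuple.isPure_entry (a : Tuple) (i : ℕ) : (a.entry i).IsPure := by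
  rcases lt_or_ge i a.length with h | h
  · rw [a.entry_eq h]; exact a[i].2
  · simpa [Tuple.entry, h] using ⟨.basic .top, trivial⟩

section Semantics

variable {D : Finset ℕ}

open Classical in
/-- The truth value of `α` under `s`. -/
noncomputable def truth (s : Assignment D) (α : Formula) : Bool :=
  decide (Team.Sat ({s} : Team D) α)

theorem Tuple.value_eq_value_iff {s s' : Assignment D} {a b : Tuple} (h : a.length = b.length) :
    a.value s = b.value s' ↔ ∀ i < a.length, truth s (a.entry i) = truth s' (b.entry i) := by
  have key (s : Assignment D) (a : Tuple) : a.value s = a.map fun α => truth s α.1 := rfl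
  rw [key, key, List.ext_getElem_iff]
  simp only [List.length_map, h, true_and, List.getElem_map]
  constructor
  · intro H i hi
    rw [a.entry_eq (h ▸ hi), b.entry_eq hi]
    exact H i hi hi
  · intro H i hi _
    rw [← a.entry_eq (h ▸ hi), ← b.entry_eq hi]
    exact H i hi

/-- A disjunction whose second part is a condition on single assignments.  Lax and strict
disjunction agree here. -/
theorem sat_dis_of_flat {σ : Bool} {φ ψ : Formula} {Q : Assignment D → Prop}
    (hψ : ∀ U : Team D, U.Sat ψ ↔ ∀ s ∈ U, Q s) (T : Team D) :
    T.Sat (dis σ φ ψ) ↔ ∃ S : Team D, S ⊆ T ∧ S.Sat φ ∧ ∀ s ∈ T, s ∉ S → Q s := by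
  cases σ
  · constructor
    · rintro ⟨S, U, rfl, hS, hU⟩
      exact ⟨S, Set.subset_union_left, hS, fun s hs hsS =>
        (hψ U).1 hU s (hs.resolve_left hsS)⟩
    · rintro ⟨S, hST, hS, h⟩
      exact ⟨S, T \ S, Set.union_sdiff_cancel hST, hS, (hψ _).2 fun s hs => h s hs.1 hs.2⟩
  · constructor
    · rintro ⟨S, U, rfl, -, hS, hU⟩
      exact ⟨S, Set.subset_union_left, hS, fun s hs hsS =>
        (hψ U).1 hU s (hs.resolve_left hsS)⟩
    · rintro ⟨S, hST, hS, h⟩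
      exact ⟨S, T \ S, Set.union_sdiff_cancel hST, Set.inter_sdiff_self S T, hS,
        (hψ _).2 fun s hs => h s hs.1 hs.2⟩

theorem sat_dis_flat {σ : Bool} {φ ψ : Formula} {Q Q' : Assignment D → Prop}
    (hφ : ∀ U : Team D, U.Sat φ ↔ ∀ s ∈ U, Q s) (hψ : ∀ U : Team D, U.Sat ψ ↔ ∀ s ∈ U, Q' s)
    (T : Team D) : T.Sat (dis σ φ ψ) ↔ ∀ s ∈ T, Q s ∨ Q' s := by
  rw [sat_dis_of_flat hψ]
  constructor
  · rintro ⟨S, -, hS, h⟩ s hs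
    by_cases hsS : s ∈ S
    · exact .inl ((hφ S).1 hS s hsS)
    · exact .inr (h s hs hsS)
  · intro h
    exact ⟨{s ∈ T | Q s}, fun s hs => hs.1, (hφ _).2 fun s hs => hs.2,
      fun s hs hsS => (h s hs).resolve_left fun hq => hsS ⟨hs, hq⟩⟩

theorem sat_conj_flat {φ ψ : Formula} {Q Q' : Assignment D → Prop}
    (hφ : ∀ U : Team D, U.Sat φ ↔ ∀ s ∈ U, Q s) (hψ : ∀ U : Team D, U.Sat ψ ↔ ∀ s ∈ U, Q' s)
    (T : Team D) : T.Sat (conj φ ψ) ↔ ∀ s ∈ T, Q s ∧ Q' s := by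
  rw [Team.Sat, hφ, hψ]
  exact forall₂_and.symm

theorem sat_sub {σ : Bool} {φ : Formula} (T : Team D) :
    T.Sat (sub σ φ) ↔ ∃ S : Team D, S ⊆ T ∧ S.Sat φ := by
  rw [sub, sat_dis_of_flat (Q := fun _ => True) fun U => by simp [Team.Sat]]
  simp

theorem sat_tilde {φ : Formula} (T : Team D) : T.Sat (tilde φ) ↔ ¬ T.Sat φ := by
  rw [Team.Sat]

theorem sat_conj {φ ψ : Formula} (T : Team D) : T.Sat (conj φ ψ) ↔ T.Sat φ ∧ T.Sat ψ := by
  rw [Team.Sat]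

theorem sat_bot (T : Team D) : T.Sat bot ↔ T = ∅ := by
  rw [Team.Sat]

theorem sat_orB {φ ψ : Formula} (T : Team D) : T.Sat (orB φ ψ) ↔ T.Sat φ ∨ T.Sat ψ := by
  rw [orB, sat_tilde, sat_conj, sat_tilde, sat_tilde]; tauto

theorem sat_bigConj {n : ℕ} {F : ℕ → Formula} (T : Team D) :
    T.Sat (bigConj n F) ↔ ∀ i < n, T.Sat (F i) := by
  induction n with
  | zero => simp [bigConj, Team.Sat]
  | succ n ih => rw [bigConj, sat_conj, ih, Nat.forall_lt_succ_right]

theorem sat_bothValues {F : Bool → Formula} (T : Team D) :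
    T.Sat (bothValues F) ↔ ∀ x, T.Sat (F x) := by
  rw [bothValues, sat_conj, Bool.forall_bool, and_comm]

theorem withDis_false (α : Formula) : withDis false α = α := by
  induction α <;> simp_all [withDis, dis]

/-- Purely propositional formulas express conditions on single assignments, also after the lax
disjunctions have been made strict. -/
theorem sat_withDis {σ : Bool} {α : Formula} (hα : α.IsPure) (T : Team D) :
    T.Sat (withDis σ α) ↔ ∀ s ∈ T, truth s α = true := by
  have flat : ∃ Q : Assignment D → Prop, ∀ (σ : Bool) (T : Team D),
      T.Sat (withDis σ α) ↔ ∀ s ∈ T, Q s := by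
    obtain ⟨h, h'⟩ := hα
    clear T
    induction h with
    | basic h =>
      cases h with
      | top => exact ⟨fun _ => True, fun σ T => by simp [withDis, Team.Sat]⟩
      | bot =>
        exact ⟨fun _ => False, fun σ T => by
          simp [withDis, Team.Sat, Set.eq_empty_iff_forall_notMem]⟩
      | pos p => exact ⟨fun s => ∃ h : p ∈ D, s ⟨p, h⟩ = true, fun σ T => by
          simp [withDis, Team.Sat]⟩
      | neg p => exact ⟨fun s => ∃ h : p ∈ D, s ⟨p, h⟩ = false, fun σ T => by
          simp [withDis, Team.Sat]⟩
    | tildeBasic | tilde => exact h'.elim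
    | conj _ _ _ ih ih' =>
      obtain ⟨Q, hQ⟩ := ih h'.1
      obtain ⟨Q', hQ'⟩ := ih' h'.2
      exact ⟨_, fun σ => sat_conj_flat (hQ σ) (hQ' σ)⟩
    | lax _ _ _ ih ih' =>
      obtain ⟨Q, hQ⟩ := ih h'.1
      obtain ⟨Q', hQ'⟩ := ih' h'.2
      exact ⟨_, fun σ => sat_dis_flat (hQ σ) (hQ' σ)⟩
    | strict h => simp at h
  obtain ⟨Q, hQ⟩ := flat
  have truth_iff (s : Assignment D) : truth s α = true ↔ Q s := by
    have := hQ false {s}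
    rw [withDis_false] at this
    simpa [truth] using this
  rw [hQ]
  exact forall₂_congr fun s _ => (truth_iff s).symm

theorem sat_lit {σ x : Bool} {α : Formula} (hα : α.IsPure) (T : Team D) :
    T.Sat (lit σ x α) ↔ ∀ s ∈ T, truth s α = x := by
  cases x
  · simp only [lit, Bool.false_eq_true, if_false, sat_tilde, sat_sub, sat_conj, sat_bot,
      sat_withDis hα]
    constructor
    · intro h s hs
      by_contra hx
      exact h ⟨{s}, by simpa using hs, by simp, by simpa using hx⟩
    · rintro h ⟨S, hST, hS, h'⟩
      obtain ⟨s, hs⟩ := Set.nonempty_iff_ne_empty.2 hS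
      have := h s (hST hs)
      rw [h' s hs] at this
      exact Bool.noConfusion this
  · exact sat_withDis hα T

theorem not_sat_lit {σ x : Bool} {α : Formula} (hα : α.IsPure) (T : Team D) :
    ¬ T.Sat (lit σ x α) ↔ ∃ s ∈ T, truth s α = !x := by
  rw [sat_lit hα]
  push Not
  exact exists_congr fun s => and_congr_right fun _ => Bool.eq_not.symm

theorem sat_isConst {σ : Bool} {α : Formula} (hα : α.IsPure) (T : Team D) :
    T.Sat (isConst σ α) ↔ ∀ s ∈ T, ∀ s' ∈ T, truth s α = truth s' α := by
  rw [isConst, sat_orB, sat_lit hα, sat_lit hα]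
  constructor
  · rintro (h | h) s hs s' hs' <;> rw [h s hs, h s' hs']
  · intro h
    by_cases h' : ∃ s ∈ T, truth s α = true
    · obtain ⟨s, hs, hs1⟩ := h'
      exact .inl fun s' hs' => (h s' hs' s hs).trans hs1
    · exact .inr fun s hs => by simpa using fun h1 => h' ⟨s, hs, h1⟩

theorem sat_constAll {σ : Bool} {a : Tuple} (T : Team D) :
    T.Sat (constAll σ a) ↔ ∀ s ∈ T, ∀ s' ∈ T, a.value s = a.value s' := by
  simp only [constAll, sat_bigConj, sat_isConst (a.isPure_entry _), Tuple.value_eq_value_iff rfl]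
  exact ⟨fun h s hs s' hs' i hi => h i hi s hs s' hs', fun h i hi s hs s' hs' => h s hs s' hs' i hi⟩

theorem sat_hasBoth {σ : Bool} {α : Formula} (hα : α.IsPure) (T : Team D) :
    T.Sat (hasBoth σ α) ↔ ∀ x, ∃ s ∈ T, truth s α = x := by
  rw [hasBoth, sat_conj, sat_tilde, sat_tilde, not_sat_lit hα, not_sat_lit hα, Bool.forall_bool]
  rfl

theorem sat_sub_crossMatch {σ x : Bool} {μ : Formula} {a b : Tuple} (hμ : μ.IsPure)
    (hab : a.length = b.length) (T : Team D) :
    T.Sat (sub σ (crossMatch σ x μ a b)) ↔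
      ∃ s ∈ T, ∃ s' ∈ T, truth s μ = x ∧ truth s' μ = (!x) ∧ a.value s = b.value s' := by
  have part (z : Bool) (i : ℕ) := sat_dis_flat (σ := σ) (D := D)
    (sat_conj_flat (sat_lit (σ := σ) (x := x) hμ)
      (sat_lit (σ := σ) (x := z) (a.isPure_entry i)))
    (sat_conj_flat (sat_lit (σ := σ) (x := !x) hμ)
      (sat_lit (σ := σ) (x := z) (b.isPure_entry i)))
  simp only [sat_sub, crossMatch, sat_conj, sat_hasBoth hμ, sat_bigConj, sat_orB, part]
  constructor
  · rintro ⟨S, hST, hboth, h⟩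
    obtain ⟨s, hs, hsx⟩ := hboth x
    obtain ⟨s', hs', hsx'⟩ := hboth !x
    refine ⟨s, hST hs, s', hST hs', hsx, hsx', (Tuple.value_eq_value_iff hab).2 fun i hi => ?_⟩
    rcases h i hi with h | h
    all_goals
      have h₁ := h s hs
      have h₂ := h s' hs'
      simp_all
  · rintro ⟨s, hs, s', hs', hsx, hsx', hv⟩
    rw [Tuple.value_eq_value_iff hab] at hv
    refine ⟨{s, s'}, by rintro t (rfl | rfl) <;> assumption, fun y => ?_, fun i hi => ?_⟩
    · rcases Bool.eq_or_eq_not y x with rfl | rfl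
      · exact ⟨s, by simp, hsx⟩
      · exact ⟨s', by simp, hsx'⟩
    · have := hv i hi
      cases hz : truth s (a.entry i)
      · right
        rintro t (rfl | rfl)
        · exact .inl ⟨hsx, hz⟩
        · exact .inr ⟨hsx', by rw [← this, hz]⟩
      · left
        rintro t (rfl | rfl)
        · exact .inl ⟨hsx, hz⟩
        · exact .inr ⟨hsx', by rw [← this, hz]⟩

theorem sat_corner {σ x y : Bool} {α β : Formula} (hα : α.IsPure) (hβ : β.IsPure) (T : Team D) :
    T.Sat (corner σ x α y β) ↔ ∀ s ∈ T, truth s α = x ∨ truth s β = y :=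
  sat_dis_flat (sat_lit hα) (sat_lit hβ) T

theorem not_sat_corner {σ x y : Bool} {α β : Formula} (hα : α.IsPure) (hβ : β.IsPure)
    (T : Team D) :
    ¬ T.Sat (corner σ x α y β) ↔ ∃ s ∈ T, truth s α = (!x) ∧ truth s β = !y := by
  rw [sat_corner hα hβ]
  push Not
  simp only [Bool.eq_not]

/-! ### Equivalence of the atoms and the formulas -/

open DependencyAtom

theorem satBy_dep_iff (σ : Bool) (a b : Tuple) (T : Team D) :
    (dep a b).SatBy T ↔ T.Sat (depFormula σ a b) := by
  simp only [SatBy, depFormula, sat_tilde, sat_sub, sat_conj, sat_constAll]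
  constructor
  · rintro h ⟨S, hST, ha, hb⟩
    exact hb fun s hs s' hs' => h s (hST hs) s' (hST hs') (ha s hs s' hs')
  · intro h s hs s' hs' ha
    by_contra hb
    refine h ⟨{s, s'}, by rintro t (rfl | rfl) <;> assumption, ?_, fun H => hb ?_⟩
    · rintro t (rfl | rfl) t' (rfl | rfl) <;> simp [ha]
    · exact H s (by simp) s' (by simp)

theorem satBy_excl_iff (σ : Bool) {a b : Tuple} (hab : a.length = b.length) (T : Team D) :
    (excl a b).SatBy T ↔ T.Sat (exclFormula σ a b) := by
  have hagree (i : ℕ) := sat_dis_flat (σ := σ) (D := D)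
    (sat_conj_flat (sat_lit (σ := σ) (x := true) (a.isPure_entry i))
      (sat_lit (σ := σ) (x := true) (b.isPure_entry i)))
    (sat_conj_flat (sat_lit (σ := σ) (x := false) (a.isPure_entry i))
      (sat_lit (σ := σ) (x := false) (b.isPure_entry i)))
  simp only [SatBy, exclFormula, sat_conj, sat_bigConj, sat_bothValues, sat_tilde,
    sat_sub_crossMatch (a.isPure_entry _) hab]
  simp only [sat_sub, sat_conj, sat_tilde, sat_bot, sat_bigConj, agree, hagree]
  constructor
  · refine fun h => ⟨?_, ?_⟩
    · rintro ⟨S, hST, hS, h'⟩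
      obtain ⟨s, hs⟩ := Set.nonempty_iff_ne_empty.2 hS
      refine h s (hST hs) s (hST hs) ((Tuple.value_eq_value_iff hab).2 fun i hi => ?_)
      rcases h' i hi s hs with h | h <;> rw [h.1, h.2]
    · rintro j - x ⟨s, hs, s', hs', -, -, hv⟩
      exact h s hs s' hs' hv
  · rintro ⟨h, h'⟩ s hs s' hs' hv
    by_cases hss : ∀ j < a.length, truth s (a.entry j) = truth s' (a.entry j)
    · refine h ⟨{s'}, by simpa using hs', by simp, fun i hi t ht => ?_⟩
      obtain rfl : t = s' := ht
      have := (hss i hi).symm.trans ((Tuple.value_eq_value_iff hab).1 hv i hi)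
      cases hz : truth t (a.entry i) <;> simp_all
    · push Not at hss
      obtain ⟨j, hj, hne⟩ := hss
      exact h' j hj (truth s (a.entry j)) ⟨s, hs, s', hs', rfl, Bool.eq_not.2 hne.symm, hv⟩

theorem satBy_incl_iff (σ : Bool) {a b : Tuple} (hab : a.length = b.length) (T : Team D) :
    (incl a b).SatBy T ↔ T.Sat (inclFormula σ a b) := by
  simp only [SatBy, inclFormula, sat_bigConj, sat_bothValues, sat_tilde,
    sat_dis_of_flat (sat_lit (b.isPure_entry _)), sat_conj, not_sat_lit (b.isPure_entry _),
    sat_dis_flat (sat_lit (b.isPure_entry _)) (sat_lit (a.isPure_entry _)),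
    sat_sub_crossMatch (b.isPure_entry _) hab]
  constructor
  · rintro h j hj x ⟨S, hST, ⟨hS, ⟨s, hs, hsx⟩, hno⟩, hrest⟩
    obtain ⟨s', hs', hv⟩ := h s (hST hs)
    have hsa := (hS s hs).resolve_left (by simp [hsx])
    have hsb := ((Tuple.value_eq_value_iff hab).1 hv j hj).symm.trans hsa
    refine hno ⟨s, hs, s', ?_, hsx, by simpa using hsb, hv⟩
    by_contra hn
    simp [hrest s' hs' hn] at hsb
  · intro h s hs
    by_contra hno
    -- The assignment `s` is no witness for itself, so `a` and `b` disagree on it at some index.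
    have : ¬ ∀ j < a.length, truth s (a.entry j) = truth s (b.entry j) := fun H =>
      hno ⟨s, hs, (Tuple.value_eq_value_iff hab).2 H⟩
    push Not at this
    obtain ⟨j, hj, hne⟩ := this
    have hne' : truth s (b.entry j) = !truth s (a.entry j) := Bool.eq_not.2 hne.symm
    refine h j hj (truth s (a.entry j)) ⟨{t ∈ T | t = s ∨ truth t (b.entry j) =
      truth s (a.entry j)}, fun t ht => ht.1, ⟨?_, ⟨s, ⟨hs, .inl rfl⟩, hne'⟩, ?_⟩, ?_⟩
    · rintro t ⟨ht, rfl | h⟩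
      · exact .inr rfl
      · exact .inl h
    · rintro ⟨t, ⟨ht, rfl | h₁⟩, t', ⟨ht', -⟩, h₂, -, hv⟩
      · exact hno ⟨t', ht', hv⟩
      · simp [h₁] at h₂
    · intro t ht hn
      exact Bool.eq_not.2 fun h => hn ⟨ht, .inr h⟩

theorem sat_anonSingle {σ : Bool} {a : Tuple} {β : Formula} (hβ : β.IsPure) (T : Team D) :
    T.Sat (anonSingle σ a β) ↔ ∀ s ∈ T, ∃ s' ∈ T, a.value s = a.value s' ∧
      truth s β ≠ truth s' β := by
  simp only [anonSingle, sat_bothValues, sat_tilde, sat_dis_of_flat (sat_lit hβ), sat_conj,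
    not_sat_lit hβ, sat_sub, sat_hasBoth hβ, sat_constAll]
  constructor
  · intro h s hs
    by_contra hno
    refine h (!truth s β) ⟨{t ∈ T | t = s ∨ truth t β = !truth s β}, fun t ht => ht.1,
      ⟨⟨s, ⟨hs, .inl rfl⟩, by simp⟩, ?_⟩, ?_⟩
    · rintro ⟨U, hU, hboth, hconst⟩
      obtain ⟨t, ht, htβ⟩ := hboth (truth s β)
      obtain ⟨t', ht', htβ'⟩ := hboth (!truth s β)
      obtain rfl : t = s := (hU ht).2.resolve_right (by simp [htβ])
      exact hno ⟨t', (hU ht').1, hconst _ ht _ ht', by simp [htβ']⟩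
    · intro t ht hn
      exact Bool.eq_not.2 fun h => hn ⟨ht, .inr h⟩
  · rintro h x ⟨S, hST, ⟨⟨s, hs, hsx⟩, hno⟩, hrest⟩
    obtain ⟨s', hs', hv, hne⟩ := h s (hST hs)
    have hsx' : truth s' β = x := by
      rw [hsx] at hne; simpa using Bool.eq_not.2 hne.symm
    have hsS' : s' ∈ S := by
      by_contra hn
      simp [hrest s' hs' hn] at hsx'
    refine hno ⟨{s, s'}, by rintro t (rfl | rfl) <;> assumption, fun y => ?_, ?_⟩
    · rcases Bool.eq_or_eq_not y x with rfl | rfl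
      · exact ⟨s', by simp, hsx'⟩
      · exact ⟨s, by simp, hsx⟩
    · rintro t (rfl | rfl) t' (rfl | rfl) <;> simp [hv]

theorem exists_of_sat_bigDis {σ : Bool} {n : ℕ} {F : ℕ → Formula} {T : Team D}
    (h : T.Sat (bigDis σ n F)) {s : Assignment D} (hs : s ∈ T) :
    ∃ i < n, ∃ S : Team D, S ⊆ T ∧ s ∈ S ∧ S.Sat (F i) := by
  induction n generalizing T with
  | zero => simp [bigDis, sat_bot] at h; simp [h] at hs
  | succ n ih =>
    obtain ⟨S, U, rfl, hS, hU⟩ : ∃ S U : Team D, S ∪ U = T ∧ S.Sat (bigDis σ n F) ∧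
        U.Sat (F n) := by
      cases σ
      · exact h
      · obtain ⟨S, U, h₁, -, h₂⟩ := h
        exact ⟨S, U, h₁, h₂⟩
    rcases hs with hs | hs
    · obtain ⟨i, hi, V, hV, h'⟩ := ih hS hs
      exact ⟨i, by omega, V, hV.trans Set.subset_union_left, h'⟩
    · exact ⟨n, by omega, U, Set.subset_union_right, hs, hU⟩

/-- A disjunction holds if the team can be partitioned into teams for its members; this is what
strict disjunctions require. -/
theorem sat_bigDis_of_partition {σ : Bool} {n : ℕ} {F : ℕ → Formula} {T : Team D}
    (p : Assignment D → ℕ) (hp : ∀ s ∈ T, p s < n) (h : ∀ i < n, Team.Sat {s ∈ T | p s = i} (F i)) :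
    T.Sat (bigDis σ n F) := by
  induction n generalizing T with
  | zero => exact (sat_bot T).2 (Set.eq_empty_of_forall_notMem fun s hs => by simpa using hp s hs)
  | succ n ih =>
    have hS : Team.Sat {s ∈ T | p s < n} (bigDis σ n F) := by
      refine ih (fun s hs => hs.2) fun i hi => ?_
      convert h i (by omega) using 1
      ext s
      simp only [Set.mem_ofPred_eq]
      constructor
      · exact fun h => ⟨h.1.1, h.2⟩
      · exact fun h => ⟨⟨h.1, h.2 ▸ hi⟩, h.2⟩
    have hU : {s ∈ T | p s < n} ∪ {s ∈ T | p s = n} = T := by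
      ext s
      simp only [Set.mem_union, Set.mem_ofPred_eq, ← and_or_left, and_iff_left_iff_imp]
      intro hs
      have := hp s hs
      omega
    have hI : {s ∈ T | p s < n} ∩ {s ∈ T | p s = n} = ∅ := by
      refine Set.eq_empty_of_forall_notMem fun s hs => ?_
      have h₁ := hs.1.2
      have h₂ := hs.2.2
      omega
    cases σ
    · exact ⟨_, _, hU, hS, h n (by omega)⟩
    · exact ⟨_, _, hU, hI, hS, h n (by omega)⟩

open Classical in
theorem satBy_anon_iff (σ : Bool) (a b : Tuple) (T : Team D) :
    (anon a b).SatBy T ↔ T.Sat (anonFormula σ a b) := by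
  simp only [SatBy]
  constructor
  · intro h
    -- All assignments with the same values of `a` are sent to the same entry of `b`, namely to the
    -- first one that takes both values on this class.
    let good (s : Assignment D) (j : ℕ) : Prop :=
      ∃ t ∈ T, ∃ t' ∈ T, a.value t = a.value s ∧ a.value t' = a.value s ∧
        truth t (b.entry j) ≠ truth t' (b.entry j)
    have hgood : ∀ s ∈ T, ∃ j, j < b.length ∧ good s j := by
      intro s hs
      obtain ⟨s', hs', hv, hne⟩ := h s hs
      rw [Ne, Tuple.value_eq_value_iff rfl] at hne
      push Not at hne
      obtain ⟨j, hj, hne⟩ := hne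
      exact ⟨j, hj, s, hs, s', hs', rfl, hv.symm, hne⟩
    let p (s : Assignment D) : ℕ :=
      if h : ∃ j, j < b.length ∧ good s j then Nat.find h else 0
    have hp : ∀ s ∈ T, p s < b.length ∧ good s (p s) := by
      intro s hs
      simp only [p, dif_pos (hgood s hs)]
      exact Nat.find_spec (hgood s hs)
    have hpp : ∀ s s', a.value s = a.value s' → p s = p s' := by
      intro s s' hv
      simp only [p, good, hv]
    refine sat_bigDis_of_partition p (fun s hs => (hp s hs).1) fun j hj => ?_
    rw [sat_anonSingle (b.isPure_entry j)]
    rintro s ⟨hs, rfl⟩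
    obtain ⟨t, ht, t', ht', hv, hv', hne⟩ := (hp s hs).2
    by_cases hst : truth s (b.entry (p s)) = truth t (b.entry (p s))
    · exact ⟨t', ⟨ht', hpp _ _ hv'⟩, hv'.symm, hst ▸ hne⟩
    · exact ⟨t, ⟨ht, hpp _ _ hv⟩, hv.symm, hst⟩
  · intro h s hs
    obtain ⟨j, hj, S, hST, hsS, hS⟩ := exists_of_sat_bigDis h hs
    obtain ⟨s', hs', hv, hne⟩ := (sat_anonSingle (b.isPure_entry j) S).1 hS s hsS
    exact ⟨s', hST hs', hv, fun H => hne ((Tuple.value_eq_value_iff rfl).1 H j hj)⟩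

theorem Tuple.value_append (s : Assignment D) (a b : Tuple) :
    Tuple.value s (a ++ b) = a.value s ++ b.value s := by
  simp [Tuple.value]

theorem Tuple.value_append_eq_iff {s s' : Assignment D} {a b : Tuple} :
    Tuple.value s (a ++ b) = Tuple.value s' (a ++ b) ↔
      a.value s = a.value s' ∧ b.value s = b.value s' := by
  rw [Tuple.value_append, Tuple.value_append]
  exact ⟨fun h => List.append_inj h (by simp [Tuple.value]), fun h => by rw [h.1, h.2]⟩

/-- The meaning of one part of the formula for conditional independence. -/
theorem sat_indepCorner {σ : Bool} {a b c : Tuple} {α β : Formula} (hα : α.IsPure) (hβ : β.IsPure)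
    (x y : Bool) (T : Team D) :
    T.Sat (indepCorner σ a b c α β x y) ↔
      ∀ s ∈ T, ∀ s' ∈ T, truth s α = x → truth s β = y → truth s' α = (!x) → truth s' β = (!y) →
        c.value s = c.value s' → ∃ s'' ∈ T, truth s'' α = x ∧ truth s'' β = (!y) ∧
          a.value s = a.value s'' ∧ c.value s = c.value s'' ∧ b.value s' = b.value s'' := by
  have hcell := sat_conj_flat (D := D) (sat_lit (σ := σ) (x := x) hα)
    (sat_lit (σ := σ) (x := !y) hβ)
  simp only [indepCorner, sat_tilde, sat_dis_of_flat (sat_corner hα hβ),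
    sat_dis_of_flat hcell, sat_dis_of_flat (sat_lit hα), sat_dis_of_flat (sat_lit hβ), sat_conj,
    not_sat_corner hα hβ, sat_sub, sat_constAll, Bool.not_not]
  constructor
  · intro h s hs s' hs' hx hy hx' hy' hc
    by_contra hno
    refine h ⟨{t ∈ T | t = s ∨ t = s' ∨ (truth t α = x ∧ truth t β = !y)}, fun t ht => ht.1,
      ⟨⟨⟨s, ⟨hs, .inl rfl⟩, hx, hy⟩, ⟨s', ⟨hs', .inr (.inl rfl)⟩, hx', hy'⟩⟩,
        ⟨{s, s'}, ?_, ?_, ?_⟩, ?_⟩, ?_⟩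
    · rintro t (rfl | rfl)
      · exact ⟨hs, .inl rfl⟩
      · exact ⟨hs', .inr (.inl rfl)⟩
    · rintro t (rfl | rfl) t' (rfl | rfl) <;> simp [hc]
    · rintro t ⟨-, rfl | rfl | h⟩ ht
      · simp at ht
      · simp at ht
      · exact h
    · rintro ⟨U, hU, ⟨⟨t, ht, htx, hty⟩, ⟨t', ht', htx', hty'⟩, ⟨t'', ht'', htx'', hty''⟩⟩, hUc,
        ⟨Sa, -, hSa, hSa'⟩, ⟨Sb, -, hSb, hSb'⟩⟩
      obtain rfl : t = s := by
        rcases (hU ht).2 with h | rfl | h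
        · exact h
        · simp [htx] at hx'
        · simp [hty] at h
      obtain rfl : t' = s' := by
        rcases (hU ht').2 with rfl | h | h
        · simp [htx] at htx'
        · exact h
        · simp [htx'] at h
      have mema : ∀ r ∈ U, truth r α = x → r ∈ Sa := fun r hr hrx => by
        by_contra hn
        simp [hSa' r hr hn] at hrx
      have memb : ∀ r ∈ U, truth r β = (!y) → r ∈ Sb := fun r hr hry => by
        by_contra hn
        simp [hSb' r hr hn] at hry
      exact hno ⟨t'', (hU ht'').1, htx'', hty'', hSa _ (mema t ht htx) _ (mema t'' ht'' htx''),
        hUc _ ht _ ht'', hSb _ (memb t' ht' hty') _ (memb t'' ht'' hty'')⟩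
    · intro t ht hn
      by_contra hcon
      push Not at hcon
      exact hn ⟨ht, .inr (.inr ⟨by simpa using Bool.eq_not.2 hcon.1, Bool.eq_not.2 hcon.2⟩)⟩
  · rintro h ⟨S, hST, ⟨⟨⟨s, hs, hx, hy⟩, ⟨s', hs', hx', hy'⟩⟩, ⟨S₀, -, hS₀, hS₀'⟩, hno⟩, hrest⟩
    have hc : c.value s = c.value s' := by
      refine hS₀ s ?_ s' ?_
      · by_contra hn
        simp [(hS₀' s hs hn).2] at hy
      · by_contra hn
        simp [(hS₀' s' hs' hn).1] at hx'
    obtain ⟨s'', hs'', hx'', hy'', ha, hc', hb⟩ := h s (hST hs) s' (hST hs') hx hy hx' hy' hc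
    have hsS'' : s'' ∈ S := by
      by_contra hn
      rcases hrest s'' hs'' hn with h | h
      · simp [h] at hx''
      · simp [h] at hy''
    refine hno ⟨{s, s', s''}, by rintro t (rfl | rfl | rfl) <;> assumption,
      ⟨⟨s, by simp, hx, hy⟩, ⟨s', by simp, hx', hy'⟩, ⟨s'', by simp, hx'', hy''⟩⟩, ?_,
      ⟨{s, s''}, ?_, ?_, ?_⟩, ⟨{s', s''}, ?_, ?_, ?_⟩⟩
    · rintro t (rfl | rfl | rfl) t' (rfl | rfl | rfl) <;> simp [hc, ← hc']
    · rintro t (rfl | rfl) <;> simp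
    · rintro t (rfl | rfl) t' (rfl | rfl) <;> simp [ha]
    · rintro t (rfl | rfl | rfl) hn
      · simp at hn
      · exact hx'
      · simp at hn
    · rintro t (rfl | rfl) <;> simp
    · rintro t (rfl | rfl) t' (rfl | rfl) <;> simp [hb]
    · rintro t (rfl | rfl | rfl) hn
      · exact hy
      · simp at hn
      · simp at hn

theorem satBy_condIndep_iff (σ : Bool) (a b c : Tuple) (T : Team D) :
    (condIndep a b c).SatBy T ↔ T.Sat (indepFormula σ a b c) := by
  simp only [SatBy, indepFormula, sat_bigConj, sat_bothValues,
    sat_indepCorner (a.isPure_entry _) (b.isPure_entry _), Tuple.value_append_eq_iff]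
  constructor
  · rintro h j hj l hl x y s hs s' hs' h₁ h₂ h₃ h₄ hc
    obtain ⟨s'', hs'', ⟨ha, hc'⟩, hb⟩ := h s hs s' hs' hc
    refine ⟨s'', hs'', ?_, ?_, ha, hc', hb⟩
    · rw [← (Tuple.value_eq_value_iff rfl).1 ha j hj, h₁]
    · rw [← (Tuple.value_eq_value_iff rfl).1 hb l hl, h₄]
  · intro h s hs s' hs' hc
    by_cases ha : a.value s = a.value s'
    · exact ⟨s', hs', ⟨ha, hc⟩, rfl⟩
    by_cases hb : b.value s' = b.value s
    · exact ⟨s, hs, ⟨rfl, rfl⟩, hb⟩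
    rw [Tuple.value_eq_value_iff rfl] at ha hb
    push Not at ha hb
    obtain ⟨j, hj, ha⟩ := ha
    obtain ⟨l, hl, hb⟩ := hb
    obtain ⟨s'', hs'', -, -, h₁, h₂, h₃⟩ := h j hj l hl _ _ s hs s' hs' rfl rfl
      (Bool.eq_not.2 ha.symm) (Bool.eq_not.2 hb) hc
    exact ⟨s'', hs'', ⟨h₁, h₂⟩, h₃⟩

end Semantics

/-! ### The defining formulas belong to the logic -/

/-- The connectives `∼`, `∧` and the disjunction that `σ` selects. -/
def connectives (σ : Bool) : Set Connective :=
  {Connective.tilde, Connective.conj, if σ then Connective.strict else Connective.lax}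

namespace Formula

/-- `φ` is a formula with the connectives selected by `σ` and propositions in `V`. -/
def Over (σ : Bool) (V : Finset ℕ) (φ : Formula) : Prop :=
  φ.PL (connectives σ) ∧ φ.props ⊆ V

namespace Over

variable {σ : Bool} {V : Finset ℕ} {φ ψ : Formula}

theorem top : Over σ V top := ⟨.basic .top, by simp [props]⟩

theorem bot : Over σ V bot := ⟨.basic .bot, by simp [props]⟩

theorem tilde (h : Over σ V φ) : Over σ V (tilde φ) :=
  ⟨.tilde (by simp [connectives]) h.1, h.2⟩

theorem conj (h : Over σ V φ) (h' : Over σ V ψ) : Over σ V (conj φ ψ) :=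
  ⟨.conj (by simp [connectives]) h.1 h'.1, Finset.union_subset h.2 h'.2⟩

theorem dis (h : Over σ V φ) (h' : Over σ V ψ) : Over σ V (dis σ φ ψ) := by
  cases σ
  · exact ⟨.lax (by simp [connectives]) h.1 h'.1, Finset.union_subset h.2 h'.2⟩
  · exact ⟨.strict (by simp [connectives]) h.1 h'.1, Finset.union_subset h.2 h'.2⟩

theorem orB (h : Over σ V φ) (h' : Over σ V ψ) : Over σ V (orB φ ψ) :=
  (h.tilde.conj h'.tilde).tilde

theorem sub (h : Over σ V φ) : Over σ V (sub σ φ) := h.dis top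

theorem bigConj {n : ℕ} {F : ℕ → Formula} (h : ∀ i < n, Over σ V (F i)) :
    Over σ V (bigConj n F) := by
  induction n with
  | zero => exact top
  | succ n ih => exact (ih fun i hi => h i (by omega)).conj (h n (by omega))

theorem bigDis {n : ℕ} {F : ℕ → Formula} (h : ∀ i < n, Over σ V (F i)) :
    Over σ V (bigDis σ n F) := by
  induction n with
  | zero => exact bot
  | succ n ih => exact (ih fun i hi => h i (by omega)).dis (h n (by omega))

theorem bothValues {F : Bool → Formula} (h : ∀ x, Over σ V (F x)) : Over σ V (bothValues F) :=
  (h true).conj (h false)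

theorem withDis {α : Formula} (hα : α.IsPure) (hV : α.props ⊆ V) : Over σ V (withDis σ α) := by
  obtain ⟨h, h'⟩ := hα
  induction h with
  | basic h => cases h <;> exact ⟨.basic (by constructor), hV⟩
  | tildeBasic | tilde => exact h'.elim
  | conj _ _ _ ih ih' =>
    exact (ih (Finset.union_subset_left hV) h'.1).conj (ih' (Finset.union_subset_right hV) h'.2)
  | lax _ _ _ ih ih' =>
    exact (ih (Finset.union_subset_left hV) h'.1).dis (ih' (Finset.union_subset_right hV) h'.2)
  | strict h => simp at h

theorem lit {x : Bool} {α : Formula} (hα : α.IsPure) (hV : α.props ⊆ V) :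
    Over σ V (lit σ x α) := by
  cases x
  · exact (bot.tilde.conj (withDis hα hV)).sub.tilde
  · exact withDis hα hV

end Over

end Formula

theorem Tuple.props_entry_subset (a : Tuple) {i : ℕ} (hi : i < a.length) :
    (a.entry i).props ⊆ a.props := by
  rw [a.entry_eq hi]
  have : ∀ α ∈ a, α.1.props ⊆ a.props := by
    clear hi
    induction a with
    | nil => simp
    | cons β a ih =>
      intro α hα
      rcases List.mem_cons.1 hα with rfl | hα
      · exact Finset.subset_union_left
      · exact (ih α hα).trans Finset.subset_union_right
  exact this _ (List.getElem_mem hi)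

namespace Formula.Over

variable {σ : Bool} {V : Finset ℕ} {a b c : Tuple}

theorem lit_entry {x : Bool} (ha : a.props ⊆ V) {i : ℕ} (hi : i < a.length) :
    Over σ V (Formula.lit σ x (a.entry i)) :=
  lit (a.isPure_entry i) ((a.props_entry_subset hi).trans ha)

theorem constAll (ha : a.props ⊆ V) : Over σ V (constAll σ a) :=
  bigConj fun _ hi => (lit_entry ha hi).orB (lit_entry ha hi)

theorem hasBoth_entry (ha : a.props ⊆ V) {i : ℕ} (hi : i < a.length) :
    Over σ V (hasBoth σ (a.entry i)) :=
  (lit_entry ha hi).tilde.conj (lit_entry ha hi).tilde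

theorem crossMatch_entry {x : Bool} (hab : a.length = b.length) (ha : a.props ⊆ V)
    (hb : b.props ⊆ V) (hc : c.props ⊆ V) {j : ℕ} (hj : j < c.length) :
    Over σ V (crossMatch σ x (c.entry j) a b) :=
  (hasBoth_entry hc hj).conj (bigConj fun _ hi =>
    (((lit_entry hc hj).conj (lit_entry ha hi)).dis
      ((lit_entry hc hj).conj (lit_entry hb (hab ▸ hi)))).orB
    (((lit_entry hc hj).conj (lit_entry ha hi)).dis
      ((lit_entry hc hj).conj (lit_entry hb (hab ▸ hi)))))

theorem depFormula (ha : a.props ⊆ V) (hb : b.props ⊆ V) : Over σ V (depFormula σ a b) :=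
  ((constAll ha).conj (constAll hb).tilde).sub.tilde

theorem exclFormula (hab : a.length = b.length) (ha : a.props ⊆ V) (hb : b.props ⊆ V) :
    Over σ V (exclFormula σ a b) :=
  (bot.tilde.conj (bigConj fun _ hi =>
    ((lit_entry ha hi).conj (lit_entry hb (hab ▸ hi))).dis
      ((lit_entry ha hi).conj (lit_entry hb (hab ▸ hi))))).sub.tilde.conj
    (bigConj fun _ hj => bothValues fun _ => (crossMatch_entry hab ha hb ha hj).sub.tilde)

theorem inclFormula (hab : a.length = b.length) (ha : a.props ⊆ V) (hb : b.props ⊆ V) :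
    Over σ V (inclFormula σ a b) :=
  bigConj fun _ hj => bothValues fun _ =>
    ((((lit_entry hb (hab ▸ hj)).dis (lit_entry ha hj)).conj ((lit_entry hb (hab ▸ hj)).tilde.conj
      (crossMatch_entry hab ha hb hb (hab ▸ hj)).sub.tilde)).dis (lit_entry hb (hab ▸ hj))).tilde

theorem anonFormula (ha : a.props ⊆ V) (hb : b.props ⊆ V) : Over σ V (anonFormula σ a b) :=
  bigDis fun _ hj => bothValues fun _ =>
    (((lit_entry hb hj).tilde.conj ((hasBoth_entry hb hj).conj (constAll ha)).sub.tilde).dis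
      (lit_entry hb hj)).tilde

theorem indepFormula (ha : a.props ⊆ V) (hb : b.props ⊆ V) (hc : c.props ⊆ V) :
    Over σ V (indepFormula σ a b c) := by
  refine bigConj fun j hj => bigConj fun l hl => bothValues fun x => bothValues fun y => ?_
  have hα (z : Bool) : Over σ V (Formula.lit σ z (a.entry j)) := lit_entry ha hj
  have hβ (z : Bool) : Over σ V (Formula.lit σ z (b.entry l)) := lit_entry hb hl
  have hcorner (u v : Bool) : Over σ V (corner σ u (a.entry j) v (b.entry l)) :=
    (hα u).dis (hβ v)
  exact ((((hcorner _ _).tilde.conj (hcorner _ _).tilde).conj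
    (((constAll hc).dis ((hα _).conj (hβ _))).conj
      (((hcorner _ _).tilde.conj ((hcorner _ _).tilde.conj (hcorner _ _).tilde)).conj
        ((constAll hc).conj (((constAll ha).dis (hα _)).conj
          ((constAll hb).dis (hβ _))))).sub.tilde)).dis (hcorner _ _)).tilde

end Formula.Over

/-! ### Lengths -/

namespace Formula

theorem length_top : top.length = 1 := rfl

theorem length_bot : bot.length = 1 := rfl

theorem length_tilde (φ : Formula) : (tilde φ).length = φ.length + 1 := rfl

theorem length_conj (φ ψ : Formula) : (conj φ ψ).length = φ.length + ψ.length + 3 := by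
  simp [length, tokens]; omega

theorem length_dis (σ : Bool) (φ ψ : Formula) :
    (dis σ φ ψ).length = φ.length + ψ.length + 3 := by
  cases σ <;> simp [dis, length, tokens] <;> omega

theorem length_pos (φ : Formula) : 1 ≤ φ.length := by
  cases φ <;> simp [length, tokens]

theorem length_withDis (σ : Bool) (φ : Formula) : (withDis σ φ).length = φ.length := by
  induction φ with
  | lax φ ψ ih ih' =>
    rw [withDis, length_dis, ih, ih']
    exact (length_dis false φ ψ).symm
  | strict φ ψ ih ih' =>
    exact (length_dis true _ _).trans (ih ▸ ih' ▸ (length_dis true φ ψ).symm)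
  | conj φ ψ ih ih' => rw [withDis, length_conj, length_conj, ih, ih']
  | tilde φ ih => rw [withDis, length_tilde, length_tilde, ih]
  | _ => rfl

theorem length_sub (σ : Bool) (φ : Formula) : (sub σ φ).length = φ.length + 4 := by
  rw [sub, length_dis, length_top]

theorem length_orB (φ ψ : Formula) : (orB φ ψ).length = φ.length + ψ.length + 6 := by
  rw [orB, length_tilde, length_conj, length_tilde, length_tilde]; omega

/-- As all formulas have positive length, additive constants are absorbed by the factor; the same is
done in the bounds below, whose constants are not optimal. -/
theorem length_lit_le (σ x : Bool) (α : Formula) : (lit σ x α).length ≤ 11 * α.length := by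
  have := α.length_pos
  cases x <;> simp only [lit, Bool.false_eq_true, if_false, if_true, length_tilde, length_sub,
    length_conj, length_bot, length_withDis] <;> omega

theorem length_bigConj_le {n : ℕ} {F : ℕ → Formula} {f : ℕ → ℕ}
    (h : ∀ i < n, (F i).length + 3 ≤ f i) :
    (bigConj n F).length ≤ 1 + ∑ i ∈ Finset.range n, f i := by
  induction n with
  | zero => exact le_rfl
  | succ n ih =>
    have h₁ := ih fun i hi => h i (by omega)
    have h₂ := h n (by omega)
    rw [bigConj, length_conj, Finset.sum_range_succ]
    omega

theorem length_bigDis_le {σ : Bool} {n : ℕ} {F : ℕ → Formula} {f : ℕ → ℕ}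
    (h : ∀ i < n, (F i).length + 3 ≤ f i) :
    (bigDis σ n F).length ≤ 1 + ∑ i ∈ Finset.range n, f i := by
  induction n with
  | zero => exact le_rfl
  | succ n ih =>
    have h₁ := ih fun i hi => h i (by omega)
    have h₂ := h n (by omega)
    rw [bigDis, length_dis, Finset.sum_range_succ]
    omega

theorem length_bothValues_le {F : Bool → Formula} {n : ℕ} (h : ∀ x, (F x).length ≤ n) :
    (bothValues F).length ≤ 2 * n + 3 := by
  have h₁ := h true
  have h₂ := h false
  rw [bothValues, length_conj]
  omega

end Formula

theorem Tuple.size_append (a b : Tuple) : Tuple.size (a ++ b) = a.size + b.size := by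
  simp [Tuple.size]

theorem Tuple.sum_length_entry (a : Tuple) :
    ∑ i ∈ Finset.range a.length, (a.entry i).length = a.size := by
  induction a with
  | nil => rfl
  | cons α a ih =>
    rw [List.length_cons, Finset.sum_range_succ']
    simp only [Tuple.size, List.map_cons, List.sum_cons] at ih ⊢
    rw [add_comm, ← ih]
    rfl

theorem Tuple.length_le_size (a : Tuple) : a.length ≤ a.size := by
  rw [← a.sum_length_entry]
  simpa using Finset.sum_le_sum fun i (_ : i ∈ Finset.range a.length) => (a.entry i).length_pos

theorem Tuple.length_entry_le_size (a : Tuple) {i : ℕ} (hi : i < a.length) :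
    (a.entry i).length ≤ a.size := by
  rw [← a.sum_length_entry]
  exact Finset.single_le_sum (f := fun i => (a.entry i).length) (fun _ _ => Nat.zero_le _)
    (Finset.mem_range.2 hi)

namespace Formula

variable (σ : Bool)

theorem length_constAll_le (a : Tuple) : (constAll σ a).length ≤ 31 * a.size + 1 := by
  refine (length_bigConj_le (f := fun i => 31 * (a.entry i).length) fun i _ => ?_).trans ?_
  · have := (a.entry i).length_pos
    have h₁ := length_lit_le σ true (a.entry i)
    have h₂ := length_lit_le σ false (a.entry i)
    rw [isConst, length_orB]
    omega
  · rw [← Finset.mul_sum, a.sum_length_entry]; omega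

theorem length_hasBoth_le (α : Formula) : (hasBoth σ α).length ≤ 27 * α.length := by
  have := α.length_pos
  have h₁ := length_lit_le σ true α
  have h₂ := length_lit_le σ false α
  rw [hasBoth, length_conj, length_tilde, length_tilde]
  omega

theorem length_depFormula_le (a b : Tuple) :
    (depFormula σ a b).length ≤ 31 * (Tuple.size (a ++ b) + 1) := by
  have h₁ := length_constAll_le σ a
  have h₂ := length_constAll_le σ b
  rw [depFormula, length_tilde, length_sub, length_conj, length_tilde, Tuple.size_append]
  omega

/-- The formula `μ` is repeated for every index, which is the source of the factor `n` in the bounds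
for exclusion and inclusion. -/
theorem length_crossMatch_le (x : Bool) (μ : Formula) {a b : Tuple} (hab : a.length = b.length) :
    (crossMatch σ x μ a b).length ≤
      31 * μ.length + 71 * (a.length * μ.length) + 22 * (a.size + b.size) := by
  have hμ := μ.length_pos
  have h₁ := length_hasBoth_le σ μ
  have h₂ := length_bigConj_le (n := a.length) (F := fun i =>
    orB (dis σ (conj (lit σ x μ) (lit σ true (a.entry i)))
        (conj (lit σ (!x) μ) (lit σ true (b.entry i))))
      (dis σ (conj (lit σ x μ) (lit σ false (a.entry i)))
        (conj (lit σ (!x) μ) (lit σ false (b.entry i)))))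
    (f := fun i => 71 * μ.length + (22 * (a.entry i).length + 22 * (b.entry i).length))
    fun i _ => by
      have h₁ := length_lit_le σ x μ
      have h₂ := length_lit_le σ (!x) μ
      have h₃ := length_lit_le σ true (a.entry i)
      have h₄ := length_lit_le σ false (a.entry i)
      have h₅ := length_lit_le σ true (b.entry i)
      have h₆ := length_lit_le σ false (b.entry i)
      simp only [length_orB, length_dis, length_conj]
      omega
  have h₃ := b.sum_length_entry
  rw [← hab] at h₃
  rw [Finset.sum_add_distrib, Finset.sum_const, Finset.card_range, smul_eq_mul,
    Finset.sum_add_distrib, ← Finset.mul_sum, ← Finset.mul_sum, a.sum_length_entry, h₃] at h₂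
  rw [crossMatch, length_conj]
  linarith

theorem length_exclFormula_le {a b : Tuple} (hab : a.length = b.length) :
    (exclFormula σ a b).length ≤ 400 * (a.length * Tuple.size (a ++ b) + 1) := by
  have hb := b.sum_length_entry
  rw [← hab] at hb
  have h₁ := length_bigConj_le (n := a.length) (F := fun i => agree σ (a.entry i) (b.entry i))
    (f := fun i => 34 * (a.entry i).length + 22 * (b.entry i).length) fun i _ => by
      have h₀ := (a.entry i).length_pos
      have h₃ := length_lit_le σ true (a.entry i)
      have h₄ := length_lit_le σ false (a.entry i)
      have h₅ := length_lit_le σ true (b.entry i)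
      have h₆ := length_lit_le σ false (b.entry i)
      simp only [agree, length_dis, length_conj]
      omega
  have h₂ := length_bigConj_le (n := a.length) (F := fun j => bothValues fun x =>
    tilde (sub σ (crossMatch σ x (a.entry j) a b)))
    (f := fun j => (16 + 44 * (a.size + b.size)) + (62 + 142 * a.length) * (a.entry j).length)
    fun j _ => by
      have := length_bothValues_le (F := fun x => tilde (sub σ (crossMatch σ x (a.entry j) a b)))
        (n := 31 * (a.entry j).length + 71 * (a.length * (a.entry j).length) +
          22 * (a.size + b.size) + 5) fun x => by
          have := length_crossMatch_le σ x (a.entry j) hab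
          simp only [length_tilde, length_sub]
          omega
      linarith
  rw [Finset.sum_add_distrib, ← Finset.mul_sum, ← Finset.mul_sum, a.sum_length_entry, hb] at h₁
  rw [Finset.sum_add_distrib, Finset.sum_const, Finset.card_range, smul_eq_mul, ← Finset.mul_sum,
    a.sum_length_entry] at h₂
  simp only [exclFormula, length_conj, length_tilde, length_sub, length_bot, Tuple.size_append]
  have ha := a.length_le_size
  rcases Nat.eq_zero_or_pos a.length with h0 | h0
  · have ha0 : a = [] := List.length_eq_zero_iff.1 h0
    have hb0 : b = [] := List.length_eq_zero_iff.1 (hab ▸ h0)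
    subst ha0 hb0
    simp [Tuple.size] at h₁ h₂ ⊢
    omega
  · nlinarith [Nat.mul_le_mul_right (a.size + b.size) h0, Nat.zero_le (a.length * b.size),
      Nat.zero_le (a.length * a.size)]

theorem length_inclFormula_le {a b : Tuple} (hab : a.length = b.length) :
    (inclFormula σ a b).length ≤ 400 * (a.length * Tuple.size (a ++ b) + 1) := by
  have hb := b.sum_length_entry
  rw [← hab] at hb
  have h₂ := length_bigConj_le (n := a.length) (F := fun j => bothValues fun x =>
    tilde (dis σ (conj (dis σ (lit σ x (b.entry j)) (lit σ x (a.entry j)))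
      (conj (tilde (lit σ x (b.entry j)))
        (tilde (sub σ (crossMatch σ (!x) (b.entry j) a b)))))
      (lit σ (!x) (b.entry j))))
    (f := fun j => (44 + 44 * (a.size + b.size)) + (22 * (a.entry j).length +
      (128 + 142 * a.length) * (b.entry j).length))
    fun j _ => by
      have := length_bothValues_le (F := fun x =>
        tilde (dis σ (conj (dis σ (lit σ x (b.entry j)) (lit σ x (a.entry j)))
          (conj (tilde (lit σ x (b.entry j)))
            (tilde (sub σ (crossMatch σ (!x) (b.entry j) a b)))))
          (lit σ (!x) (b.entry j))))
        (n := 19 + 33 * (b.entry j).length + 11 * (a.entry j).length +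
          (31 * (b.entry j).length + 71 * (a.length * (b.entry j).length) +
          22 * (a.size + b.size))) fun x => by
          have := length_crossMatch_le σ (!x) (b.entry j) hab
          have h₁ := length_lit_le σ x (a.entry j)
          have h₂ := length_lit_le σ x (b.entry j)
          have h₃ := length_lit_le σ (!x) (b.entry j)
          simp only [length_tilde, length_sub, length_dis, length_conj]
          omega
      linarith
  rw [Finset.sum_add_distrib, Finset.sum_const, Finset.card_range, smul_eq_mul,
    Finset.sum_add_distrib, ← Finset.mul_sum, ← Finset.mul_sum, a.sum_length_entry, hb] at h₂
  rw [Tuple.size_append]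
  refine h₂.trans ?_
  have ha := a.length_le_size
  rcases Nat.eq_zero_or_pos a.length with h0 | h0
  · have ha0 : a = [] := List.length_eq_zero_iff.1 h0
    have hb0 : b = [] := List.length_eq_zero_iff.1 (hab ▸ h0)
    subst ha0 hb0
    simp [Tuple.size]
  · nlinarith [Nat.mul_le_mul_right (a.size + b.size) h0, Nat.zero_le (a.length * b.size),
      Nat.zero_le (a.length * a.size)]

theorem length_anonFormula_le (a b : Tuple) :
    (anonFormula σ a b).length ≤
      150 * (max a.length 1 * b.size + b.length * a.size + 1) := by
  have h₂ := length_bigDis_le (σ := σ) (n := b.length) (F := fun j => anonSingle σ a (b.entry j))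
    (f := fun j => (40 + 62 * a.size) + 98 * (b.entry j).length)
    fun j _ => by
      have := length_bothValues_le (F := fun x =>
        tilde (dis σ (conj (tilde (lit σ x (b.entry j)))
          (tilde (sub σ (conj (hasBoth σ (b.entry j)) (constAll σ a)))))
          (lit σ (!x) (b.entry j))))
        (n := 17 + 49 * (b.entry j).length + 31 * a.size) fun x => by
          have h₁ := length_hasBoth_le σ (b.entry j)
          have h₂ := length_lit_le σ x (b.entry j)
          have h₃ := length_lit_le σ (!x) (b.entry j)
          have h₄ := length_constAll_le σ a
          simp only [length_tilde, length_sub, length_dis, length_conj]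
          omega
      rw [anonSingle]
      omega
  rw [Finset.sum_add_distrib, Finset.sum_const, Finset.card_range, smul_eq_mul, ← Finset.mul_sum,
    b.sum_length_entry] at h₂
  refine h₂.trans ?_
  have hb := b.length_le_size
  have := Nat.mul_le_mul_right b.size (le_max_right a.length 1)
  nlinarith

theorem length_indepCorner_le (a b c : Tuple) {α β : Formula} (hα : α.length ≤ a.size)
    (hβ : β.length ≤ b.size) (x y : Bool) :
    (indepCorner σ a b c α β x y).length ≤ 400 * (a.size + b.size + c.size) := by
  have h₁ := length_lit_le σ x α
  have h₂ := length_lit_le σ (!x) α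
  have h₃ := length_lit_le σ y β
  have h₄ := length_lit_le σ (!y) β
  have h₅ := length_constAll_le σ a
  have h₆ := length_constAll_le σ b
  have h₇ := length_constAll_le σ c
  have h₈ := α.length_pos
  simp only [indepCorner, corner, length_tilde, length_sub, length_dis, length_conj]
  omega

theorem length_indepFormula_le (a b c : Tuple) :
    (indepFormula σ a b c).length ≤
      2000 * (a.length * (a.length + b.length + c.length) * Tuple.size (a ++ b ++ c) + 1) := by
  set S := a.size + b.size + c.size with hS
  have hin : ∀ j < a.length, (bigConj b.length fun l => bothValues fun x => bothValues fun y =>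
      indepCorner σ a b c (a.entry j) (b.entry l) x y).length + 3 ≤
        4 + b.length * (12 + 1600 * S) := fun j hj => by
    have := length_bigConj_le (n := b.length) (F := fun l => bothValues fun x => bothValues fun y =>
      indepCorner σ a b c (a.entry j) (b.entry l) x y) (f := fun _ => 12 + 1600 * S) fun l hl => by
        have : (bothValues fun x => bothValues fun y =>
            indepCorner σ a b c (a.entry j) (b.entry l) x y).length ≤ _ :=
          length_bothValues_le (n := 2 * (400 * S) + 3) fun x => length_bothValues_le
            (n := 400 * S) fun y => length_indepCorner_le σ a b c
              (a.length_entry_le_size hj) (b.length_entry_le_size hl) x y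
        omega
    rw [Finset.sum_const, Finset.card_range, smul_eq_mul] at this
    omega
  have hout := length_bigConj_le hin
  rw [Finset.sum_const, Finset.card_range, smul_eq_mul] at hout
  rw [Tuple.size_append, Tuple.size_append, ← hS]
  refine hout.trans ?_
  rcases Nat.eq_zero_or_pos a.length with h0 | h0
  · simp [h0]
  have hS1 : 1 ≤ S := by
    have := a.length_le_size
    omega
  have h₁ : a.length * b.length * 1 ≤ a.length * b.length * S := Nat.mul_le_mul_left _ hS1
  have h₂ : a.length * 1 * 1 ≤ a.length * a.length * S :=
    Nat.mul_le_mul (Nat.mul_le_mul_left _ h0) hS1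
  have h₃ := Nat.zero_le (a.length * c.length * S)
  linarith

end Formula

/-! ### Dependency atoms in propositional team logic -/

theorem exists_eq_connectives {Sg : Set Connective}
    (hSg : Sg = {Connective.tilde, Connective.conj, Connective.lax} ∨
      Sg = {Connective.tilde, Connective.conj, Connective.strict}) :
    ∃ σ, Sg = connectives σ := by
  rcases hSg with rfl | rfl
  · exact ⟨false, rfl⟩
  · exact ⟨true, rfl⟩

theorem encodeTuples_pair (a b : Tuple) : encodeTuples [a, b] = a.encode ++ b.encode := by
  simp [encodeTuples]

theorem encodeTuples_triple (a b c : Tuple) :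
    encodeTuples [a, b, c] = a.encode ++ b.encode ++ c.encode := by
  simp [encodeTuples]

theorem Formula.Over.definedBy {σ : Bool} {A : DependencyAtom} {φ : Formula}
    (h : φ.Over σ A.props) (h' : ∀ D : Finset ℕ, ∀ T : Team D, A.SatBy T ↔ T.Sat φ) :
    A.DefinedBy (connectives σ) φ :=
  ⟨h.1, h.2, fun D _ T => h' D T⟩

end

theorem mainTheorem4 (Sg : Set Connective)
    (hSg : Sg = {Connective.tilde, Connective.conj, Connective.lax} ∨
      Sg = {Connective.tilde, Connective.conj, Connective.strict}) :
    -- dependence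
    (∃ φ : Tuple → Tuple → Formula,
      (∃ C : ℕ, ∀ a b : Tuple,
        (DependencyAtom.dep a b).DefinedBy Sg (φ a b) ∧
        (φ a b).length ≤ C * ((a ++ b).size + 1)) ∧
      LogspaceComputable
        (fun x : Tuple × Tuple => x.1.encode ++ x.2.encode)
        (fun x => (φ x.1 x.2).encode)) ∧
    -- exclusion
    (∃ φ : Tuple → Tuple → Formula,
      (∃ C : ℕ, ∀ a b : Tuple, a.length = b.length →
        (DependencyAtom.excl a b).DefinedBy Sg (φ a b) ∧
        (φ a b).length ≤ C * (a.length * (a ++ b).size + 1)) ∧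
      LogspaceComputable
        (fun x : {x : Tuple × Tuple // x.1.length = x.2.length} =>
          x.1.1.encode ++ x.1.2.encode)
        (fun x => (φ x.1.1 x.1.2).encode)) ∧
    -- inclusion
    (∃ φ : Tuple → Tuple → Formula,
      (∃ C : ℕ, ∀ a b : Tuple, a.length = b.length →
        (DependencyAtom.incl a b).DefinedBy Sg (φ a b) ∧
        (φ a b).length ≤ C * (a.length * (a ++ b).size + 1)) ∧
      LogspaceComputable
        (fun x : {x : Tuple × Tuple // x.1.length = x.2.length} =>
          x.1.1.encode ++ x.1.2.encode)
        (fun x => (φ x.1.1 x.1.2).encode)) ∧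
    -- conditional independence
    (∃ φ : Tuple → Tuple → Tuple → Formula,
      (∃ C : ℕ, ∀ a b c : Tuple,
        (DependencyAtom.condIndep a b c).DefinedBy Sg (φ a b c) ∧
        (φ a b c).length ≤
          C * (a.length * (a.length + b.length + c.length) * (a ++ b ++ c).size + 1)) ∧
      LogspaceComputable
        (fun x : Tuple × Tuple × Tuple => x.1.encode ++ x.2.1.encode ++ x.2.2.encode)
        (fun x => (φ x.1 x.2.1 x.2.2).encode)) ∧
    -- anonymity
    (∃ φ : Tuple → Tuple → Formula,
      (∃ C : ℕ, ∀ a b : Tuple,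
        (DependencyAtom.anon a b).DefinedBy Sg (φ a b) ∧
        (φ a b).length ≤ C * (max a.length 1 * b.size + b.length * a.size + 1)) ∧
      LogspaceComputable
        (fun x : Tuple × Tuple => x.1.encode ++ x.2.encode)
        (fun x => (φ x.1 x.2).encode)) := by
  obtain ⟨σ, rfl⟩ := exists_eq_connectives hSg
  refine ⟨⟨Formula.depFormula σ, ⟨31, fun a b => ⟨?_, Formula.length_depFormula_le σ a b⟩⟩, ?_⟩,
    ⟨Formula.exclFormula σ, ⟨400, fun a b hab => ⟨?_, Formula.length_exclFormula_le σ hab⟩⟩, ?_⟩,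
    ⟨Formula.inclFormula σ, ⟨400, fun a b hab => ⟨?_, Formula.length_inclFormula_le σ hab⟩⟩, ?_⟩,
    ⟨Formula.indepFormula σ, ⟨2000, fun a b c => ⟨?_, Formula.length_indepFormula_le σ a b c⟩⟩, ?_⟩,
    ⟨Formula.anonFormula σ, ⟨150, fun a b => ⟨?_, Formula.length_anonFormula_le σ a b⟩⟩, ?_⟩⟩
  · exact Formula.Over.definedBy
      (.depFormula Finset.subset_union_left Finset.subset_union_right)
      fun D T => satBy_dep_iff σ a b T
  · simpa only [encodeTuples_pair] using LogspaceComputable.of_writes (Writes.depFormula (σ := σ))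
  · exact Formula.Over.definedBy
      (.exclFormula hab Finset.subset_union_left Finset.subset_union_right)
      fun D T => satBy_excl_iff σ hab T
  · simpa only [encodeTuples_pair] using LogspaceComputable.of_writes (Writes.exclFormula (σ := σ))
  · exact Formula.Over.definedBy
      (.inclFormula hab Finset.subset_union_left Finset.subset_union_right)
      fun D T => satBy_incl_iff σ hab T
  · simpa only [encodeTuples_pair] using LogspaceComputable.of_writes (Writes.inclFormula (σ := σ))
  · exact Formula.Over.definedBy
      (.indepFormula (Finset.subset_union_left.trans Finset.subset_union_left)
        (Finset.subset_union_right.trans Finset.subset_union_left) Finset.subset_union_right)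
      fun D T => satBy_condIndep_iff σ a b c T
  · simpa only [encodeTuples_triple] using
      LogspaceComputable.of_writes (Writes.indepFormula (σ := σ))
  · exact Formula.Over.definedBy
      (.anonFormula Finset.subset_union_left Finset.subset_union_right)
      fun D T => satBy_anon_iff σ a b T
  · simpa only [encodeTuples_pair] using LogspaceComputable.of_writes (Writes.anonFormula (σ := σ))
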